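/- Let $M$ be a compact smooth ($C^\infty$) Riemannian manifold without boundary, let $m$ be Lebesgue measure on $M$, i.e. the Riemannian volume measure normalized to total mass one, and let $f\colon M\to M$ be a $C^2$ local diffeomorphism. For $x\in M$ let $\|Df(x)^{-1}\|$ be the operator norm of $Df(x)^{-1}\colon T_{f(x)}M\to T_xM$ with respect to the Riemannian norms. For $\sigma\in(0,1)$, an integer $n\ge 1$ is called a $\sigma$-hyperbolic time for $x\in M$ if $$\prod_{j=n-k}^{n-1}\|Df(f^j(x))^{-1}\|\le\sigma^k\qquad\text{for every } 1\le k\le n .$$ Suppose that for some $\sigma\in(0,1)$ the first $\sigma$-hyperbolic time map $h$, which sends $x$ to the smallest $\sigma$-hyperbolic time for $x$, is defined at $m$-almost every point and is integrable with respect to $m$. Then there are $\hat\sigma\in(0,1)$ and $\theta>0$ such that for $m$-almost every $x\in M$ $$\liminf_{N\to\infty}\frac1N\,\#\{\,n<N : n \text{ is a } \hat\sigma\text{-hyperbolic time for } x\,\}\ \ge\ \theta ,$$ that is, $m$-almost every point has frequency of $\hat\sigma$-hyperbolic times bigger than $\theta$. -/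

import Mathlib

open Set Filter Topology MeasureTheory Bundle
open scoped Manifold ContDiff ENNReal

noncomputable section

namespace HypTimes

section Volume

variable {d : ℕ} {M : Type*} [TopologicalSpace M] [ChartedSpace (EuclideanSpace ℝ (Fin d)) M]
  [RiemannianBundle (fun x : M ↦ TangentSpace (𝓡 d) x)]

/-- The `i`-th coordinate vector field of the chart `φ`, at the point with coordinates `y`. -/
def coordVector (φ : OpenPartialHomeomorph M (EuclideanSpace ℝ (Fin d)))
    (y : EuclideanSpace ℝ (Fin d)) (i : Fin d) : TangentSpace (𝓡 d) (φ.symm y) :=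
  mfderiv (𝓡 d) (𝓡 d) φ.symm y (EuclideanSpace.single i (1 : ℝ))

/-- The density `√(det (g_ij))` of the Riemannian volume in the chart `φ`, where
`g_ij = ⟪∂_i, ∂_j⟫`. -/
def volumeDensity (φ : OpenPartialHomeomorph M (EuclideanSpace ℝ (Fin d)))
    (y : EuclideanSpace ℝ (Fin d)) : ℝ :=
  √ (Matrix.gram ℝ (coordVector φ y)).det

/-- The Riemannian volume of the domain of the chart `φ`: the image under `φ⁻¹` of
`√(det (g_ij)) dy` on the target of `φ`. -/
def chartVolume [MeasurableSpace M]
    (φ : OpenPartialHomeomorph M (EuclideanSpace ℝ (Fin d))) : Measure M :=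
  (((volume : Measure (EuclideanSpace ℝ (Fin d))).restrict φ.target).withDensity
    (fun y ↦ ENNReal.ofReal (volumeDensity φ y))).map φ.symm

variable (d M) in
/-- The Riemannian volume measure, glued from the chart volumes. On a smooth manifold these agree on
the overlaps of charts, so that their supremum, in the lattice of measures, is the measure
that restricts to `chartVolume φ` on the domain of each chart `φ` of the atlas. -/
def riemannianVolume [MeasurableSpace M] : Measure M :=
  ⨆ φ ∈ atlas (EuclideanSpace ℝ (Fin d)) M, chartVolume φ

variable (d M) in
/-- Lebesgue measure on `M`: the Riemannian volume, normalized to have total mass one. -/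
def lebesgue [MeasurableSpace M] : Measure M :=
  (riemannianVolume d M univ)⁻¹ • riemannianVolume d M

end Volume

section HyperbolicTimes

variable {d : ℕ} {M : Type*} [TopologicalSpace M] [ChartedSpace (EuclideanSpace ℝ (Fin d)) M]
  [RiemannianBundle (fun x : M ↦ TangentSpace (𝓡 d) x)]

variable (d) in
/-- `‖Df(x)⁻¹‖`, the operator norm of `Df(x)⁻¹ : T_{f x} M → T_x M` for the Riemannian norms. -/
def invDerivNorm (f : M → M) (x : M) : ℝ :=
  ‖(mfderiv (𝓡 d) (𝓡 d) f x).inverse‖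

variable (d) in
/-- `n ≥ 1` is a `σ`-hyperbolic time for `x`. -/
def IsHyperbolicTime (f : M → M) (σ : ℝ) (n : ℕ) (x : M) : Prop :=
  1 ≤ n ∧ ∀ k : ℕ, 1 ≤ k → k ≤ n →
    ∏ j ∈ Finset.Ico (n - k) n, invDerivNorm d f (f^[j] x) ≤ σ ^ k

variable (d) in
/-- The first `σ`-hyperbolic time of `x`, with the value `0` if there is none. -/
def firstHyperbolicTime (f : M → M) (σ : ℝ) (x : M) : ℕ :=
  sInf {n : ℕ | IsHyperbolicTime d f σ n x}

variable (d) in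
/-- The lower frequency `liminf_N #{n < N : n is a σ-hyperbolic time for x} / N`. -/
def hyperbolicFrequency (f : M → M) (σ : ℝ) (x : M) : ℝ :=
  liminf (fun N : ℕ ↦ ({n : ℕ | n < N ∧ IsHyperbolicTime d f σ n x}.ncard : ℝ) / N) atTop

end HyperbolicTimes

end HypTimes

end

/-! Write `a` for the norm of the inverse derivative. In positive dimension it is continuous and
positive on a compact space, so `log a` is bounded. The proof controls the Birkhoff averages of `log
a` without an invariant measure.

Bounded density. At a hyperbolic time `n` of `z`, suitable inverse branches of `f` contract
geometrically all the way back from a ball of fixed radius around `f^[n] z`. The logarithm of the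
Jacobian is locally Lipschitz because `f` is `C^2`, so the total distortion is bounded by a
geometric series. A disjoint family of such preballs then shows that `f^[n]`, restricted to the
points with hyperbolic time `n`, pushes volume to a measure with density at most `C`, uniformly in
`n` (`exists_domination_at_hyperbolicTime`).

Domination. Split an orbit of length `j` at its last hyperbolic time up to `j`. Hyperbolic times
concatenate, so the remaining piece has none. Hence every iterate of `m` is at most a multiple of
the tower measure `∑ i, f^i_* (m | h > i)`, whose mass is the integral of `h`
(`exists_dominating_measure`).

Averages. The segment up to a first hyperbolic time has average of `log a` at most `log σ`. Orbits
can therefore be cut into good blocks of length at most `K`, apart from visits to a set that is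
small for the dominating measure. If the upper limit of the averages exceeded some `c > log σ` on a
set of positive measure, the same orbits could also be cut into blocks with average above some `c₁ >
log σ`. Comparing the two decompositions gives a contradiction (`ae_eventually_birkhoff_sum_le`).

Pliss. Averages eventually at most `log σ / 2` force a positive frequency of record times of an
auxiliary sum, and these are hyperbolic times for a weaker rate
(`le_frequency_of_eventually_sum_log_le`). -/

namespace HypTimes

/-! ### Combinatorics of sequences: record times and block decompositions. -/

section Combinatorics

/-- The partial sums of a sequence bounded by `B` are at most `B` times the number of record times:
a form of the Pliss lemma. -/
lemma sum_le_mul_card_records (u : ℕ → ℝ) {B : ℝ} (hB : 0 ≤ B) (hu : ∀ j, u j ≤ B) (N : ℕ) :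
    ∀ m ≤ N, ∑ j ∈ Finset.range m, u j ≤ B * ({n : ℕ | n < N + 1 ∧ 1 ≤ n ∧ ∀ k < n,
      ∑ j ∈ Finset.range k, u j ≤ ∑ j ∈ Finset.range n, u j}.ncard : ℝ) := by
  induction N with
  | zero =>
    intro m hm
    obtain rfl : m = 0 := by omega
    simpa using by positivity
  | succ N ih =>
    intro m hm
    set R : ℕ → Set ℕ := fun N ↦ {n : ℕ | n < N + 1 ∧ 1 ≤ n ∧ ∀ k < n,
      ∑ j ∈ Finset.range k, u j ≤ ∑ j ∈ Finset.range n, u j} with hR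
    have hfin : ∀ N, (R N).Finite := fun N ↦
      (Set.finite_Iio (N + 1)).subset fun n hn ↦ hn.1
    have hmono : ((R N).ncard : ℝ) ≤ (R (N + 1)).ncard := by
      have : R N ⊆ R (N + 1) := fun n hn ↦ ⟨by have := hn.1; omega, hn.2⟩
      exact_mod_cast Set.ncard_le_ncard this (hfin _)
    rcases Nat.lt_or_ge m (N + 1) with h | h
    · exact (ih m (by omega)).trans (by gcongr)
    obtain rfl : m = N + 1 := by omega
    -- A new record adds one to the count, which pays for `u N ≤ B`. Otherwise an earlier sum is
    -- larger; this is why the induction bounds all `m ≤ N`.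
    by_cases hrec : ∀ k < N + 1, ∑ j ∈ Finset.range k, u j ≤ ∑ j ∈ Finset.range (N + 1), u j
    · have hins : insert (N + 1) (R N) ⊆ R (N + 1) := by
        rintro n (rfl | hn)
        · exact ⟨by omega, by omega, hrec⟩
        · exact ⟨by have := hn.1; omega, hn.2⟩
      have hcard : ((R N).ncard : ℝ) + 1 ≤ (R (N + 1)).ncard := by
        have h1 := Set.ncard_le_ncard hins (hfin _)
        rw [Set.ncard_insert_of_notMem (fun h ↦ by have := h.1; omega) (hfin _)] at h1
        exact_mod_cast h1
      have h2 := ih N le_rfl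
      rw [Finset.sum_range_succ]
      have h3 := hu N
      nlinarith
    · push Not at hrec
      obtain ⟨k, hk, hlt⟩ := hrec
      exact hlt.le.trans ((ih k (by omega)).trans (by gcongr))

/-- If from every time that is not bad there starts a block of length at most `K` over which the sum
of `u` is nonpositive, then the sums of `u` are controlled by the number of bad times. -/
lemma sum_le_of_blocks (K : ℕ) {Λ : ℝ} (hΛ : 0 ≤ Λ) (N : ℕ) :
    ∀ u b : ℕ → ℝ, (∀ j, u j ≤ Λ) → (∀ j, 0 ≤ b j) →
      (∀ j, 1 ≤ b j ∨ ∃ n, 1 ≤ n ∧ n ≤ K ∧ ∑ i ∈ Finset.range n, u (j + i) ≤ 0) →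
      ∑ j ∈ Finset.range N, u j ≤ Λ * (∑ j ∈ Finset.range N, b j + K) := by
  induction N using Nat.strong_induction_on with
  | _ N ih =>
    intro u b hu hb h
    rcases Nat.eq_zero_or_pos N with rfl | hN
    · simpa using by positivity
    rcases h 0 with h0 | ⟨n, hn1, hnK, hn⟩
    · obtain ⟨N, rfl⟩ : ∃ N', N = N' + 1 := ⟨N - 1, by omega⟩
      have := ih N (by omega) (fun j ↦ u (j + 1)) (fun j ↦ b (j + 1)) (fun j ↦ hu _)
        (fun j ↦ hb _) (fun j ↦ by simpa only [add_right_comm] using h (j + 1))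
      rw [Finset.sum_range_succ', Finset.sum_range_succ']
      nlinarith [hu 0]
    -- A block that overruns `N` is cut at most once, at the end; the cut costs at most `K * Λ`, the
    -- additive term of the bound.
    · rcases Nat.lt_or_ge N n with hNn | hnN
      · have h1 : ∑ j ∈ Finset.range N, u j ≤ N * Λ := by
          simpa using Finset.sum_le_card_nsmul (Finset.range N) u Λ (fun j _ ↦ hu j)
        have h2 : (N : ℝ) ≤ K := by exact_mod_cast (by omega : N ≤ K)
        have h3 : 0 ≤ ∑ j ∈ Finset.range N, b j := Finset.sum_nonneg fun j _ ↦ hb j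
        nlinarith
      · obtain ⟨N', rfl⟩ : ∃ N', N = n + N' := ⟨N - n, by omega⟩
        have := ih N' (by omega) (fun j ↦ u (n + j)) (fun j ↦ b (n + j)) (fun j ↦ hu _)
          (fun j ↦ hb _) (fun j ↦ by simpa only [add_assoc] using h (n + j))
        rw [Finset.sum_range_add, Finset.sum_range_add]
        have h3 : 0 ≤ ∑ j ∈ Finset.range n, b j := Finset.sum_nonneg fun j _ ↦ hb j
        simp only [zero_add] at hn
        nlinarith

end Combinatorics

/-! ### Hyperbolic times of a cocycle: concatenation and frequency. -/

section Abstract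

variable {X : Type*}

/-- `n` is a `σ`-hyperbolic time of `x` for the cocycle generated by `a` over `f`. -/
def IsCocycleHyperbolicTime (f : X → X) (a : X → ℝ) (σ : ℝ) (n : ℕ) (x : X) : Prop :=
  1 ≤ n ∧ ∀ k : ℕ, 1 ≤ k → k ≤ n → ∏ j ∈ Finset.Ico (n - k) n, a (f^[j] x) ≤ σ ^ k

variable {f : X → X} {a : X → ℝ} {σ : ℝ}

lemma IsCocycleHyperbolicTime.prod_le {n : ℕ} {x : X} (h : IsCocycleHyperbolicTime f a σ n x)
    {i : ℕ} (hi : i ≤ n) : ∏ j ∈ Finset.Ico i n, a (f^[j] x) ≤ σ ^ (n - i) := by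
  rcases hi.eq_or_lt with rfl | hi
  · simp
  · have := h.2 (n - i) (by omega) (by omega)
    rwa [Nat.sub_sub_self hi.le] at this

lemma isCocycleHyperbolicTime_of_prod_le {n : ℕ} {x : X} (hn : 1 ≤ n)
    (h : ∀ i < n, ∏ j ∈ Finset.Ico i n, a (f^[j] x) ≤ σ ^ (n - i)) :
    IsCocycleHyperbolicTime f a σ n x := by
  refine ⟨hn, fun k hk hkn ↦ ?_⟩
  have := h (n - k) (by omega)
  rwa [Nat.sub_sub_self hkn] at this

/-- A product ending at `n + m` either starts after `n`, and is controlled by `hm`, or splits at `n`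
into two controlled products. The case `n = 0` lets time zero serve as a starting point, although it
is not a hyperbolic time. -/
lemma IsCocycleHyperbolicTime.add (hσ : 0 ≤ σ) (ha : ∀ x, 0 ≤ a x) {n m : ℕ} {x : X}
    (hn : n = 0 ∨ IsCocycleHyperbolicTime f a σ n x)
    (hm : IsCocycleHyperbolicTime f a σ m (f^[n] x)) :
    IsCocycleHyperbolicTime f a σ (n + m) x := by
  rcases hn with rfl | hn
  · simpa using hm
  have hm1 := hm.1
  refine isCocycleHyperbolicTime_of_prod_le (by omega) fun i hi ↦ ?_
  have key : ∀ i, ∏ j ∈ Finset.Ico (n + i) (n + m), a (f^[j] x)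
      = ∏ j ∈ Finset.Ico i m, a (f^[j] (f^[n] x)) := by
    intro i
    rw [add_comm n i, add_comm n m, ← Finset.prod_Ico_add (fun j ↦ a (f^[j] x)) i m n]
    refine Finset.prod_congr rfl fun j _ ↦ ?_
    rw [add_comm, Function.iterate_add_apply]
  rcases le_or_gt n i with hni | hin
  · obtain ⟨i, rfl⟩ := Nat.exists_eq_add_of_le hni
    rw [key, Nat.add_sub_add_left]
    exact hm.prod_le (by omega)
  · rw [← Finset.prod_Ico_consecutive _ hin.le (Nat.le_add_right n m),
      show n + m - i = (n - i) + m by omega, pow_add]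
    have h2 := key 0
    rw [add_zero] at h2
    rw [h2]
    exact mul_le_mul (hn.prod_le hin.le) (by simpa using hm.prod_le (Nat.zero_le m))
      (Finset.prod_nonneg fun _ _ ↦ ha _) (by positivity)

lemma IsCocycleHyperbolicTime.sum_log_le (ha : ∀ x, 0 < a x) {n : ℕ} {x : X}
    (h : IsCocycleHyperbolicTime f a σ n x) :
    ∑ j ∈ Finset.range n, Real.log (a (f^[j] x)) ≤ Real.log σ * n := by
  have h0 := h.prod_le (Nat.zero_le n)
  rw [← Finset.range_eq_Ico, Nat.sub_zero] at h0
  have := Real.log_le_log (Finset.prod_pos fun j _ ↦ ha _) h0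
  rwa [Real.log_prod (fun j _ ↦ (ha _).ne'), Real.log_pow, mul_comm] at this

/-- Positive lower frequency of hyperbolic times, from a negative upper bound of the averages. -/
lemma le_frequency_of_eventually_sum_log_le {η s : ℝ} (hη : 0 < η) (ha : ∀ x, η ≤ a x) (hs : s < 0)
    {x : X} (h : ∀ᶠ N : ℕ in atTop, ∑ j ∈ Finset.range N, Real.log (a (f^[j] x)) ≤ s * N) :
    -s / (4 * (|Real.log η| + |s|)) ≤ liminf (fun N : ℕ ↦ ({n : ℕ | n < N ∧
      IsCocycleHyperbolicTime f a (Real.exp (s / 2)) n x}.ncard : ℝ) / N) atTop := by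
  have ha0 : ∀ x, 0 < a x := fun x ↦ hη.trans_le (ha x)
  set B := |Real.log η| + |s| with hBdef
  have hBpos : 0 < B := add_pos_of_nonneg_of_pos (abs_nonneg _) (abs_pos.2 hs.ne)
  -- A record of the sums of `u` says that every block ending there has average of `log a` at most
  -- `s / 2`, which is hyperbolicity with rate `exp (s / 2)`.
  set u : ℕ → ℝ := fun j ↦ s / 2 - Real.log (a (f^[j] x)) with hu
  have huB : ∀ j, u j ≤ B := fun j ↦ by
    have h1 := Real.log_le_log hη (ha (f^[j] x))
    have h2 := neg_abs_le (Real.log η)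
    have h3 := abs_nonneg s
    simp only [hu, hBdef]
    linarith
  have hrec : ∀ N : ℕ, {n : ℕ | n < N + 1 ∧ 1 ≤ n ∧ ∀ k < n,
      ∑ j ∈ Finset.range k, u j ≤ ∑ j ∈ Finset.range n, u j} ⊆
      {n : ℕ | n < N + 1 ∧ IsCocycleHyperbolicTime f a (Real.exp (s / 2)) n x} := by
    rintro N n ⟨hnN, hn1, hn⟩
    refine ⟨hnN, isCocycleHyperbolicTime_of_prod_le hn1 fun i hi ↦ ?_⟩
    have h1 := hn i hi
    rw [← Finset.sum_range_add_sum_Ico _ hi.le] at h1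
    have h2 : ∑ j ∈ Finset.Ico i n, Real.log (a (f^[j] x)) ≤ (n - i : ℕ) * (s / 2) := by
      have : 0 ≤ ∑ j ∈ Finset.Ico i n, u j := by linarith
      simp only [hu, Finset.sum_sub_distrib, Finset.sum_const, Nat.card_Ico, nsmul_eq_mul] at this
      linarith
    rw [← Real.log_prod (fun j _ ↦ (ha0 _).ne')] at h2
    rw [← Real.exp_nat_mul, ← Real.log_le_iff_le_exp (Finset.prod_pos fun j _ ↦ ha0 _)]
    exact h2
  refine le_liminf_of_le ?_ ?_
  · refine isCoboundedUnder_ge_of_le atTop (x := 1) fun N ↦ ?_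
    refine div_le_one_of_le₀ ?_ (Nat.cast_nonneg N)
    have : {n : ℕ | n < N ∧ IsCocycleHyperbolicTime f a (Real.exp (s / 2)) n x}.ncard ≤ N := by
      calc _ ≤ (Set.Iio N).ncard := Set.ncard_le_ncard (fun n hn ↦ hn.1) (Set.finite_Iio N)
        _ = N := by simp
    exact_mod_cast this
  · obtain ⟨N₀, hN₀⟩ := eventually_atTop.1 h
    filter_upwards [eventually_ge_atTop (N₀ + 2)] with N hN
    obtain ⟨N, rfl⟩ : ∃ N', N = N' + 1 := ⟨N - 1, by omega⟩
    have h1 := sum_le_mul_card_records u hBpos.le huB N N le_rfl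
    have h2 : ∑ j ∈ Finset.range N, u j ≥ -(s / 2) * N := by
      have := hN₀ N (by omega)
      simp only [hu, Finset.sum_sub_distrib, Finset.sum_const, Finset.card_range, nsmul_eq_mul]
      linarith
    have h3 := Set.ncard_le_ncard (hrec N)
      ((Set.finite_Iio (N + 1)).subset fun n hn ↦ hn.1)
    have h4 := mul_le_mul_of_nonneg_left (Nat.cast_le (α := ℝ).2 h3) hBpos.le
    -- Pliss gives the density `-s / (2 * B)` relative to `N`; the denominator here is `N + 1 ≤ 2 *
    -- N`, hence the factor 4.
    rw [div_le_div_iff₀ (by positivity) (by positivity)]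
    have h5 : (1 : ℝ) ≤ N := by exact_mod_cast (by omega : 1 ≤ N)
    push_cast
    nlinarith

end Abstract

/-! ### Birkhoff averages under a dominating measure, and the tower measure. -/

section Abstract

variable {X : Type*} [MeasurableSpace X] {m : Measure X} {f : X → X} {a : X → ℝ} {σ : ℝ}

lemma measurable_birkhoff_sum (hf : Measurable f) {φ : X → ℝ} (hφ : Measurable φ) (n : ℕ) :
    Measurable fun x ↦ ∑ j ∈ Finset.range n, φ (f^[j] x) :=
  Finset.measurable_sum _ fun j _ ↦ hφ.comp (hf.iterate j)

/-- If the iterates of `m` are dominated by a finite measure `ν ≪ m` and almost every orbit has a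
block over which the average of `φ` is at most `s`, then the averages of `φ` are eventually
at most `c`, for every `c > s`. -/
theorem ae_eventually_birkhoff_sum_le [IsFiniteMeasure m] (hf : Measurable f)
    {ν : Measure X} [IsFiniteMeasure ν] (hνm : ν ≪ m)
    (hν : ∀ (j : ℕ) (D : Set X), MeasurableSet D → m (f^[j] ⁻¹' D) ≤ ν D)
    {φ : X → ℝ} (hφ : Measurable φ) {L : ℝ} (hL : ∀ x, |φ x| ≤ L) {s c : ℝ} (hsc : s < c)
    (hblock : ∀ᵐ x ∂m, ∃ n : ℕ, 1 ≤ n ∧ ∑ j ∈ Finset.range n, φ (f^[j] x) ≤ s * n) :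
    ∀ᵐ x ∂m, ∀ᶠ N : ℕ in atTop, ∑ j ∈ Finset.range N, φ (f^[j] x) ≤ c * N := by
  set S : ℕ → X → ℝ := fun n x ↦ ∑ j ∈ Finset.range n, φ (f^[j] x) with hS
  have hSm : ∀ n, Measurable (S n) := measurable_birkhoff_sum hf hφ
  have hSadd : ∀ j n x, S (j + n) x = S j x + S n (f^[j] x) := fun j n x ↦ by
    simp only [hS, Finset.sum_range_add]
    congr 1
    refine Finset.sum_congr rfl fun i _ ↦ ?_
    rw [add_comm, Function.iterate_add_apply]
  -- The gap `c - c₁` makes membership in `E` survive a shift of the orbit, and the gap `c₁ - s`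
  -- gives the final contradiction.
  obtain ⟨c₁, hc₁, hc₁'⟩ := exists_between hsc
  set E : Set X := {x | ∃ᶠ N : ℕ in atTop, c * N < S N x} with hE
  have hEm : MeasurableSet E := by
    have : E = limsup (fun N : ℕ ↦ {x | c * N < S N x}) atTop := by
      ext x
      rw [mem_limsup_iff_frequently_mem]
      rfl
    rw [this]
    exact MeasurableSet.measurableSet_limsup fun N ↦ measurableSet_lt measurable_const (hSm N)
  suffices hmE : m E = 0 by
    filter_upwards [measure_eq_zero_iff_ae_notMem.1 hmE] with x hx
    simpa [hE] using hx
  -- the points without a good block of length at most `K`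
  set D : ℕ → Set X := fun K ↦ {x | ∀ n, 1 ≤ n → n ≤ K → s * n < S n x} with hD
  -- `F` consists of the starting points of some block with average above `c₁`. The sets `D' K` are
  -- the part of `F` where no such block has length at most `K`, so they decrease to the empty set.
  set F : Set X := {x | ∃ n, 1 ≤ n ∧ c₁ * n < S n x} with hF
  set D' : ℕ → Set X := fun K ↦ F ∩ {x | ∀ n, 1 ≤ n → n ≤ K → S n x ≤ c₁ * n} with hD'
  have hDm : ∀ K, MeasurableSet (D K) := fun K ↦ by
    simp only [hD, ofPred_forall]
    exact MeasurableSet.iInter fun n ↦ MeasurableSet.iInter fun _ ↦ MeasurableSet.iInter fun _ ↦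
      measurableSet_lt measurable_const (hSm n)
  have hFm : MeasurableSet F := by
    simp only [hF, ofPred_exists, ofPred_and]
    exact MeasurableSet.iUnion fun n ↦ (MeasurableSet.const _).inter
      (measurableSet_lt measurable_const (hSm n))
  have hD'm : ∀ K, MeasurableSet (D' K) := fun K ↦ by
    refine hFm.inter ?_
    simp only [ofPred_forall]
    exact MeasurableSet.iInter fun n ↦ MeasurableSet.iInter fun _ ↦ MeasurableSet.iInter fun _ ↦
      measurableSet_le (hSm n) measurable_const
  have hDlim : Tendsto (fun K ↦ ν (D K)) atTop (𝓝 0) := by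
    have h0 : ν (⋂ K, D K) = 0 := by
      refine hνm ?_
      refine measure_mono_null ?_ hblock
      intro x hx
      simp only [hD, mem_iInter, mem_ofPred_eq] at hx
      simp only [mem_compl_iff, mem_ofPred_eq, not_exists, not_and, not_le]
      exact fun n hn ↦ hx n n hn le_rfl
    rw [← h0]
    exact tendsto_measure_iInter_atTop (fun K ↦ (hDm K).nullMeasurableSet)
      (fun K K' h x hx n hn hnK ↦ hx n hn (hnK.trans h)) ⟨0, measure_ne_top _ _⟩
  have hD'lim : Tendsto (fun K ↦ ν (D' K)) atTop (𝓝 0) := by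
    have h0 : ν (⋂ K, D' K) = 0 := by
      convert measure_empty (μ := ν)
      rw [eq_empty_iff_forall_notMem]
      intro x hx
      rw [mem_iInter] at hx
      obtain ⟨n, hn, hlt⟩ := (hx 0).1
      exact absurd ((hx n).2 n hn le_rfl) (not_le.2 hlt)
    rw [← h0]
    exact tendsto_measure_iInter_atTop (fun K ↦ (hD'm K).nullMeasurableSet)
      (fun K K' h x hx ↦ ⟨hx.1, fun n hn hnK ↦ hx.2 n hn (hnK.trans h)⟩) ⟨0, measure_ne_top _ _⟩
  have hEF : ∀ x ∈ E, ∀ j, f^[j] x ∈ F := by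
    intro x hx j
    have hx' : ∃ᶠ N : ℕ in atTop, c * N < S N x := hx
    -- For `N` beyond this threshold, `c * N - S j x` exceeds `c₁ * (N - j)`: the initial segment of
    -- length `j` is absorbed.
    obtain ⟨N₀, hN₀⟩ := exists_nat_gt ((S j x - c₁ * j) / (c - c₁))
    obtain ⟨N, hN, hlt⟩ := (frequently_atTop.1 hx') (N₀ + j + 1)
    obtain ⟨n, rfl⟩ : ∃ n, N = j + n := ⟨N - j, by omega⟩
    refine ⟨n, by omega, ?_⟩
    rw [hSadd] at hlt
    have hcc : 0 < c - c₁ := by linarith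
    rw [div_lt_iff₀ hcc] at hN₀
    have h1 : (N₀ : ℝ) ≤ (j + n : ℕ) := by exact_mod_cast (by omega)
    push_cast at hlt h1
    nlinarith
  -- A common upper bound for `φ - s` and `c₁ - φ`, the summands of the two decompositions.
  set Λ : ℝ := L + |s| + |c₁| with hΛ
  have hL0 : ∀ x : X, 0 ≤ L := fun x ↦ (abs_nonneg _).trans (hL x)
  -- the two block decompositions
  have hpt : ∀ K N : ℕ, ∀ x ∈ E, (c₁ - s) * N ≤ Λ * (∑ j ∈ Finset.range N,
      ((f^[j] ⁻¹' D K).indicator 1 x + (f^[j] ⁻¹' D' K).indicator 1 x) + 2 * K) := by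
    intro K N x hx
    have hΛ0 : 0 ≤ Λ := by have := hL0 x; positivity
    have hs1 := le_abs_self s
    have hs2 := neg_abs_le s
    have hs3 := le_abs_self c₁
    have hs4 := neg_abs_le c₁
    have h1 := sum_le_of_blocks K hΛ0 N (fun j ↦ φ (f^[j] x) - s)
      (fun j ↦ (f^[j] ⁻¹' D K).indicator 1 x)
      (fun j ↦ by have := (abs_le.1 (hL (f^[j] x))).2; have := abs_nonneg c₁; simp only [hΛ]; linarith)
      (fun j ↦ indicator_nonneg (fun _ _ ↦ zero_le_one) x)
      (fun j ↦ by
        by_cases hj : f^[j] x ∈ D K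
        · left
          rw [indicator_of_mem (show x ∈ f^[j] ⁻¹' D K from hj)]
          simp
        · right
          simp only [hD, mem_ofPred_eq, not_forall, not_lt] at hj
          obtain ⟨n, hn, hnK, hle⟩ := hj
          refine ⟨n, hn, hnK, ?_⟩
          have : ∑ i ∈ Finset.range n, φ (f^[j + i] x) = S n (f^[j] x) :=
            Finset.sum_congr rfl fun i _ ↦ by rw [add_comm, Function.iterate_add_apply]
          simp only [Finset.sum_sub_distrib, this, Finset.sum_const, Finset.card_range,
            nsmul_eq_mul]
          linarith)
    have h2 := sum_le_of_blocks K hΛ0 N (fun j ↦ c₁ - φ (f^[j] x))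
      (fun j ↦ (f^[j] ⁻¹' D' K).indicator 1 x)
      (fun j ↦ by have := (abs_le.1 (hL (f^[j] x))).1; have := abs_nonneg s; simp only [hΛ]; linarith)
      (fun j ↦ indicator_nonneg (fun _ _ ↦ zero_le_one) x)
      (fun j ↦ by
        by_cases hj : f^[j] x ∈ D' K
        · left
          rw [indicator_of_mem (show x ∈ f^[j] ⁻¹' D' K from hj)]
          simp
        · right
          have hj' : ¬ ∀ n, 1 ≤ n → n ≤ K → S n (f^[j] x) ≤ c₁ * n :=
            fun h ↦ hj ⟨hEF x hx j, h⟩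
          simp only [not_forall, not_le] at hj'
          obtain ⟨n, hn, hnK, hlt⟩ := hj'
          refine ⟨n, hn, hnK, ?_⟩
          have : ∑ i ∈ Finset.range n, φ (f^[j + i] x) = S n (f^[j] x) :=
            Finset.sum_congr rfl fun i _ ↦ by rw [add_comm, Function.iterate_add_apply]
          simp only [Finset.sum_sub_distrib, this, Finset.sum_const, Finset.card_range,
            nsmul_eq_mul]
          linarith)
    -- Adding `h1` and `h2` cancels the sums of `φ` and leaves `(c₁ - s) * N` against the visits to
    -- the two bad sets.
    simp only [Finset.sum_sub_distrib, Finset.sum_const, Finset.card_range, nsmul_eq_mul] at h1 h2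
    rw [Finset.sum_add_distrib]
    nlinarith
  -- The bound `hL` yields `0 ≤ L` only in the presence of a point.
  rcases E.eq_empty_or_nonempty with hEe | ⟨x₀, hx₀⟩
  · rw [hEe, measure_empty]
  have hΛ0 : 0 ≤ Λ := by have := hL0 x₀; positivity
  have hint : ∀ K N : ℕ, (c₁ - s) * N * m.real E
      ≤ Λ * (N * (ν.real (D K) + ν.real (D' K)) + 2 * K * m.real univ) := by
    intro K N
    have hpre : ∀ (j : ℕ) {B : Set X}, MeasurableSet B → MeasurableSet (f^[j] ⁻¹' B) :=
      fun j B hB ↦ hf.iterate j hB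
    have hreal : ∀ (j : ℕ) {B : Set X}, MeasurableSet B → m.real (f^[j] ⁻¹' B) ≤ ν.real B :=
      fun j B hB ↦ ENNReal.toReal_mono (measure_ne_top _ _) (hν j B hB)
    have hI : ∀ (j : ℕ) {B : Set X}, MeasurableSet B →
        Integrable ((f^[j] ⁻¹' B).indicator (1 : X → ℝ)) m := fun j B hB ↦
      (integrable_const (1 : ℝ)).indicator (hpre j hB)
    have hG : Integrable (fun x ↦ Λ * (∑ j ∈ Finset.range N,
        ((f^[j] ⁻¹' D K).indicator 1 x + (f^[j] ⁻¹' D' K).indicator 1 x) + 2 * (K : ℝ))) m :=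
      ((integrable_finsetSum _ fun j _ ↦ (hI j (hDm K)).add (hI j (hD'm K))).add
        (integrable_const _)).const_mul _
    calc (c₁ - s) * N * m.real E = ∫ x, E.indicator (fun _ ↦ (c₁ - s) * N) x ∂m := by
          rw [integral_indicator_const _ hEm, smul_eq_mul, mul_comm]
      _ ≤ ∫ x, Λ * (∑ j ∈ Finset.range N,
          ((f^[j] ⁻¹' D K).indicator 1 x + (f^[j] ⁻¹' D' K).indicator 1 x) + 2 * (K : ℝ)) ∂m := by
          refine integral_mono ((integrable_const _).indicator hEm) hG fun x ↦ ?_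
          by_cases hx : x ∈ E
          · rw [indicator_of_mem hx]
            exact hpt K N x hx
          · rw [indicator_of_notMem hx]
            refine mul_nonneg hΛ0 (add_nonneg (Finset.sum_nonneg fun j _ ↦ ?_) (by positivity))
            exact add_nonneg (indicator_nonneg (fun _ _ ↦ zero_le_one) x)
              (indicator_nonneg (fun _ _ ↦ zero_le_one) x)
      _ = Λ * (∑ j ∈ Finset.range N, (m.real (f^[j] ⁻¹' D K) + m.real (f^[j] ⁻¹' D' K))
            + 2 * K * m.real univ) := by
          have hI2 : ∀ j ∈ Finset.range N, Integrable (fun x ↦ (f^[j] ⁻¹' D K).indicator (1 : X → ℝ) x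
              + (f^[j] ⁻¹' D' K).indicator 1 x) m := fun j _ ↦ (hI j (hDm K)).add (hI j (hD'm K))
          rw [integral_const_mul, integral_add (integrable_finsetSum _ hI2) (integrable_const _),
            integral_finsetSum _ hI2, integral_const, smul_eq_mul, mul_comm (m.real univ)]
          have hsum : ∀ j, ∫ x, ((f^[j] ⁻¹' D K).indicator (1 : X → ℝ) x
              + (f^[j] ⁻¹' D' K).indicator 1 x) ∂m
              = m.real (f^[j] ⁻¹' D K) + m.real (f^[j] ⁻¹' D' K) := fun j ↦ by
            rw [integral_add (hI j (hDm K)) (hI j (hD'm K)),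
              integral_indicator_one (hpre j (hDm K)), integral_indicator_one (hpre j (hD'm K))]
          simp only [hsum]
      _ ≤ Λ * (N * (ν.real (D K) + ν.real (D' K)) + 2 * K * m.real univ) := by
          gcongr
          refine (Finset.sum_le_card_nsmul _ _ _ fun j _ ↦
            add_le_add (hreal j (hDm K)) (hreal j (hD'm K))).trans_eq ?_
          rw [Finset.card_range, nsmul_eq_mul]
  -- Dividing by `N` with `K` fixed removes the boundary term; only afterwards does `K` tend to
  -- infinity.
  have hK : ∀ K : ℕ, (c₁ - s) * m.real E ≤ Λ * (ν.real (D K) + ν.real (D' K)) := by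
    intro K
    have hlim : Tendsto (fun N : ℕ ↦ Λ * (ν.real (D K) + ν.real (D' K))
        + Λ * (2 * K * m.real univ) / (N : ℝ)) atTop
        (𝓝 (Λ * (ν.real (D K) + ν.real (D' K)) + 0)) :=
      tendsto_const_nhds.add (tendsto_const_div_atTop_nhds_zero_nat _)
    rw [add_zero] at hlim
    refine ge_of_tendsto hlim ?_
    filter_upwards [eventually_gt_atTop 0] with N hN
    have hN' : (0 : ℝ) < N := by exact_mod_cast hN
    have := hint K N
    rw [← sub_le_iff_le_add', le_div_iff₀ hN']
    linarith
  have hlimK : Tendsto (fun K ↦ Λ * (ν.real (D K) + ν.real (D' K))) atTop (𝓝 (Λ * (0 + 0))) := by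
    have h1 := (ENNReal.tendsto_toReal ENNReal.zero_ne_top).comp hDlim
    have h2 := (ENNReal.tendsto_toReal ENNReal.zero_ne_top).comp hD'lim
    exact (h1.add h2).const_mul Λ
  have hfin := ge_of_tendsto' hlimK hK
  have hcs : 0 < c₁ - s := by linarith
  have h0 : m.real E ≤ 0 := by
    simp only [add_zero, mul_zero] at hfin
    exact nonpos_of_mul_nonpos_right hfin hcs
  exact (measureReal_eq_zero_iff (measure_ne_top _ _)).1 (le_antisymm h0 measureReal_nonneg)

lemma measurableSet_isCocycleHyperbolicTime (hf : Measurable f) (ha : Measurable a) (n : ℕ) :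
    MeasurableSet {x | IsCocycleHyperbolicTime f a σ n x} := by
  simp only [IsCocycleHyperbolicTime, ofPred_and, ofPred_forall]
  exact (MeasurableSet.const _).inter <| MeasurableSet.iInter fun k ↦ MeasurableSet.iInter fun _ ↦
    MeasurableSet.iInter fun _ ↦ measurableSet_le
      (Finset.measurable_prod _ fun j _ ↦ ha.comp (hf.iterate j)) measurable_const

/-- The tower measure over the first hyperbolic time: it is finite if the first hyperbolic time is
integrable, absolutely continuous, and it dominates all the iterates of `m`. -/
theorem exists_dominating_measure [IsFiniteMeasure m] (hf : Measure.QuasiMeasurePreserving f m m)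
    (ha : Measurable a) (ha0 : ∀ x, 0 ≤ a x) (hσ : 0 ≤ σ) {C : ℝ≥0∞} (hC : C ≠ ⊤)
    (hdom : ∀ (n : ℕ) (s : Set X), MeasurableSet s →
      m ({x | IsCocycleHyperbolicTime f a σ n x} ∩ f^[n] ⁻¹' s) ≤ C * m s)
    (hex : ∀ᵐ x ∂m, ∃ n, IsCocycleHyperbolicTime f a σ n x)
    (hint : Integrable (fun x ↦ ((sInf {n | IsCocycleHyperbolicTime f a σ n x} : ℕ) : ℝ)) m) :
    ∃ ν : Measure X, IsFiniteMeasure ν ∧ ν ≪ m ∧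
      ∀ (j : ℕ) (D : Set X), MeasurableSet D → m (f^[j] ⁻¹' D) ≤ ν D := by
  set T : ℕ → Set X := fun i ↦ {x | ∀ n ≤ i, ¬ IsCocycleHyperbolicTime f a σ n x} with hT
  have hTm : ∀ i, MeasurableSet (T i) := fun i ↦ by
    simp only [hT, ofPred_forall]
    exact MeasurableSet.iInter fun n ↦ MeasurableSet.iInter fun _ ↦
      (measurableSet_isCocycleHyperbolicTime hf.measurable ha n).compl
  have hTsum : ∑' i, m (T i) ≠ ⊤ := by
    have h1 : ∑' i, m (T i) = ∫⁻ x, ∑' i, (T i).indicator 1 x ∂m := by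
      rw [lintegral_tsum fun i ↦ (measurable_one.indicator (hTm i)).aemeasurable]
      exact tsum_congr fun i ↦ (lintegral_indicator_one (hTm i)).symm
    have h2 : ∫⁻ x, ∑' i, (T i).indicator 1 x ∂m
        = ∫⁻ x, ‖((sInf {n | IsCocycleHyperbolicTime f a σ n x} : ℕ) : ℝ)‖ₑ ∂m := by
      refine lintegral_congr_ae ?_
      -- Where hyperbolic times exist, `T i` is the event `h > i`, and summing its indicators over
      -- `i` gives `h`. Elsewhere `sInf ∅ = 0` while `x` lies in every `T i`, so `hex` is essential.
      filter_upwards [hex] with x hx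
      set h := sInf {n | IsCocycleHyperbolicTime f a σ n x}
      have hmem : ∀ i, x ∈ T i ↔ i < h := fun i ↦ by
        constructor
        · intro hi
          by_contra hlt
          exact hi h (not_lt.1 hlt) (Nat.sInf_mem hx)
        · intro hi n hn hn'
          exact absurd (Nat.sInf_le hn') (not_le.2 (hn.trans_lt hi))
      rw [tsum_eq_sum (s := Finset.range h) fun i hi ↦
        indicator_of_notMem (fun h' ↦ hi (Finset.mem_range.2 ((hmem i).1 h'))) _]
      rw [Finset.sum_congr rfl fun i hi ↦
        indicator_of_mem ((hmem i).2 (Finset.mem_range.1 hi)) (1 : X → ℝ≥0∞)]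
      simp
    rw [h1, h2]
    exact hint.2.ne
  set ν₀ : Measure X := Measure.sum fun i ↦ (m.restrict (T i)).map f^[i] with hν₀
  have hitm : ∀ i, Measurable f^[i] := fun i ↦ hf.measurable.iterate i
  have hν₀_apply : ∀ D, MeasurableSet D → ν₀ D = ∑' i, m (f^[i] ⁻¹' D ∩ T i) := fun D hD ↦ by
    rw [hν₀, Measure.sum_apply _ hD]
    refine tsum_congr fun i ↦ ?_
    rw [Measure.map_apply (hitm i) hD, Measure.restrict_apply (hitm i hD)]
  have hν₀fin : ν₀ univ ≠ ⊤ := by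
    rw [hν₀_apply _ MeasurableSet.univ]
    simpa using hTsum
  have hν₀ac : ν₀ ≪ m := by
    refine Measure.AbsolutelyContinuous.mk fun D hD h0 ↦ ?_
    rw [hν₀_apply D hD, ENNReal.tsum_eq_zero]
    intro i
    exact measure_mono_null inter_subset_left ((hf.iterate i).preimage_null h0)
  -- The summand 1 accounts for orbits with no hyperbolic time up to `j`, which are split at time
  -- zero.
  refine ⟨(C + 1) • ν₀, ⟨?_⟩, hν₀ac.smul_left _, fun j D hD ↦ ?_⟩
  · rw [Measure.smul_apply, smul_eq_mul]
    exact ENNReal.mul_lt_top (by simpa using hC.lt_top) hν₀fin.lt_top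
  have hcover : f^[j] ⁻¹' D ⊆ ⋃ i ∈ Finset.range (j + 1),
      ({x | j - i = 0 ∨ IsCocycleHyperbolicTime f a σ (j - i) x} ∩
        f^[j - i] ⁻¹' (f^[i] ⁻¹' D ∩ T i)) := by
    intro x hx
    classical
    set b := Nat.findGreatest (fun n ↦ n = 0 ∨ IsCocycleHyperbolicTime f a σ n x) j
    have hbj : b ≤ j := Nat.findGreatest_le j
    have hbP : b = 0 ∨ IsCocycleHyperbolicTime f a σ b x :=
      Nat.findGreatest_spec (P := fun n ↦ n = 0 ∨ IsCocycleHyperbolicTime f a σ n x)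
        (Nat.zero_le j) (Or.inl rfl)
    simp only [mem_iUnion, Finset.mem_range]
    refine ⟨j - b, by omega, ?_⟩
    rw [Nat.sub_sub_self hbj]
    refine ⟨hbP, ?_, ?_⟩
    · simp only [mem_preimage, ← Function.iterate_add_apply, Nat.sub_add_cancel hbj]
      exact hx
    -- A hyperbolic time `n` of `f^[b] x` would make `b + n` a later admissible time, against the
    -- maximality of `b`.
    · intro n hn hn'
      have hadd := IsCocycleHyperbolicTime.add hσ ha0 hbP hn'
      have := Nat.le_findGreatest (P := fun n ↦ n = 0 ∨ IsCocycleHyperbolicTime f a σ n x)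
        (show b + n ≤ j by omega) (Or.inr hadd)
      have := hn'.1
      omega
  have hpiece : ∀ (n : ℕ) (s : Set X), MeasurableSet s →
      m ({x | n = 0 ∨ IsCocycleHyperbolicTime f a σ n x} ∩ f^[n] ⁻¹' s) ≤ (C + 1) * m s := by
    intro n s hs
    rcases Nat.eq_zero_or_pos n with rfl | hn
    · simp only [true_or, ofPred_true, univ_inter, Function.iterate_zero, preimage_id]
      calc m s = 1 * m s := (one_mul _).symm
        _ ≤ (C + 1) * m s := by gcongr; exact le_add_self
    · simp only [hn.ne', false_or]
      exact (hdom n s hs).trans (by gcongr; exact le_self_add)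
  calc m (f^[j] ⁻¹' D) ≤ ∑ i ∈ Finset.range (j + 1), (C + 1) * m (f^[i] ⁻¹' D ∩ T i) :=
        (measure_mono hcover).trans <| (measure_biUnion_finset_le _ _).trans <|
          Finset.sum_le_sum fun i _ ↦ hpiece _ _ ((hitm i hD).inter (hTm i))
    _ ≤ ∑' i, (C + 1) * m (f^[i] ⁻¹' D ∩ T i) := ENNReal.sum_le_tsum _
    _ = ((C + 1) • ν₀) D := by
        rw [ENNReal.tsum_mul_left, Measure.smul_apply, smul_eq_mul, hν₀_apply D hD]

/-- Positive frequency of hyperbolic times from integrability of the first one, for a map whose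
iterates at hyperbolic times push `m` forward to measures with bounded density. -/
theorem exists_frequency_of_domination [IsFiniteMeasure m]
    (hf : Measure.QuasiMeasurePreserving f m m) (ha : Measurable a) {η A : ℝ} (hη : 0 < η)
    (haη : ∀ x, η ≤ a x) (haA : ∀ x, a x ≤ A) (hσ : σ ∈ Ioo (0 : ℝ) 1) {C : ℝ≥0∞} (hC : C ≠ ⊤)
    (hdom : ∀ (n : ℕ) (s : Set X), MeasurableSet s →
      m ({x | IsCocycleHyperbolicTime f a σ n x} ∩ f^[n] ⁻¹' s) ≤ C * m s)
    (hex : ∀ᵐ x ∂m, ∃ n, IsCocycleHyperbolicTime f a σ n x)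
    (hint : Integrable (fun x ↦ ((sInf {n | IsCocycleHyperbolicTime f a σ n x} : ℕ) : ℝ)) m) :
    ∃ σ' ∈ Ioo (0 : ℝ) 1, ∃ θ : ℝ, 0 < θ ∧ ∀ᵐ x ∂m, θ ≤ liminf (fun N : ℕ ↦ ({n : ℕ | n < N ∧
      IsCocycleHyperbolicTime f a σ' n x}.ncard : ℝ) / N) atTop := by
  have ha0 : ∀ x, 0 < a x := fun x ↦ hη.trans_le (haη x)
  obtain ⟨ν, hνfin, hνac, hν⟩ :=
    exists_dominating_measure hf ha (fun x ↦ (ha0 x).le) hσ.1.le hC hdom hex hint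
  have hs : Real.log σ < 0 := Real.log_neg hσ.1 hσ.2
  have hL : ∀ x, |Real.log (a x)| ≤ |Real.log η| + |Real.log A| := fun x ↦ by
    have h1 := Real.log_le_log hη (haη x)
    have h2 := Real.log_le_log (ha0 x) (haA x)
    have h3 := neg_abs_le (Real.log η)
    have h4 := le_abs_self (Real.log A)
    have h5 := abs_nonneg (Real.log η)
    have h6 := abs_nonneg (Real.log A)
    rw [abs_le]
    constructor <;> linarith
  have hev := ae_eventually_birkhoff_sum_le hf.measurable hνac hν
    (Real.measurable_log.comp ha) hL (show Real.log σ < Real.log σ / 2 by linarith)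
    (by
      filter_upwards [hex] with x ⟨n, hn⟩
      exact ⟨n, hn.1, hn.sum_log_le ha0⟩)
  -- The rate is `σ ^ (1/4)`: one halving leaves room above `log σ` for the averages, the other for
  -- the Pliss argument.
  refine ⟨Real.exp (Real.log σ / 2 / 2), ⟨Real.exp_pos _, by rw [Real.exp_lt_one_iff]; linarith⟩,
    -(Real.log σ / 2) / (4 * (|Real.log η| + |Real.log σ / 2|)), ?_, ?_⟩
  · have : 0 < |Real.log σ / 2| := abs_pos.2 (by linarith)
    have := abs_nonneg (Real.log η)
    exact div_pos (by linarith) (by linarith)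
  · filter_upwards [hev] with x hx
    exact le_frequency_of_eventually_sum_log_le hη haη (by linarith) hx

end Abstract

/-! ### Hyperbolic preballs and bounded density at hyperbolic times. -/

section Preballs

variable {X : Type*} [PseudoEMetricSpace X] [MeasurableSpace X]

/-- Near `z` the map `f` has an inverse branch defined on the ball of radius `δ` around `f z`, which
contracts distances to `f z` by `κ * a z`, and whose distortion of `μ` on the ball of radius `r` is
at most `exp (L * r)`. -/
def HasInverseBranch (f : X → X) (a : X → ℝ) (μ : Measure X) (κ δ L : ℝ) (z : X) : Prop :=
  ∃ U : Set X, IsOpen U ∧ z ∈ U ∧ MapsTo f U (Metric.eball (f z) (ENNReal.ofReal δ)) ∧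
    SurjOn f U (Metric.eball (f z) (ENNReal.ofReal δ)) ∧
    (∀ u ∈ U, edist u z ≤ ENNReal.ofReal (κ * a z) * edist (f u) (f z)) ∧
    -- One reference Jacobian `c` serves all radii `r`. The distortion tends to 1 as `r` shrinks, so
    -- that errors along a contracting orbit can be summed.
    ∃ c : ℝ≥0∞, ∀ r : ℝ, 0 ≤ r → r ≤ δ → ∀ s ⊆ Metric.eball (f z) (ENNReal.ofReal r),
      MeasurableSet s →
        c * μ s ≤ ENNReal.ofReal (Real.exp (L * r)) * μ (U ∩ f ⁻¹' s) ∧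
        μ (U ∩ f ⁻¹' s) ≤ ENNReal.ofReal (Real.exp (L * r)) * (c * μ s)

variable {f : X → X} {a : X → ℝ} {μ : Measure X} {κ δ L σ : ℝ}

lemma HasInverseBranch.mono {z : X} (h : HasInverseBranch f a μ κ δ L z) (hf : Continuous f)
    {δ' L' : ℝ} (hδ' : 0 < δ') (hδ : δ' ≤ δ) (hL : L ≤ L') :
    HasInverseBranch f a μ κ δ' L' z := by
  obtain ⟨U, hUo, hzU, -, hsurj, hcontr, c, hc⟩ := h
  refine ⟨U ∩ f ⁻¹' Metric.eball (f z) (ENNReal.ofReal δ'), hUo.inter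
    (Metric.isOpen_eball.preimage hf), ⟨hzU, Metric.mem_eball_self (by simpa using hδ')⟩,
    fun u hu ↦ hu.2, fun w hw ↦ ?_, fun u hu ↦ hcontr u hu.1, c, fun r hr hrδ s hs hsm ↦ ?_⟩
  · obtain ⟨u, hu, rfl⟩ := hsurj (Metric.eball_subset_eball (ENNReal.ofReal_le_ofReal hδ) hw)
    exact ⟨u, ⟨hu, hw⟩, rfl⟩
  · have heq : U ∩ f ⁻¹' Metric.eball (f z) (ENNReal.ofReal δ') ∩ f ⁻¹' s = U ∩ f ⁻¹' s := by
      rw [inter_assoc, ← preimage_inter, inter_eq_self_of_subset_right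
        (hs.trans (Metric.eball_subset_eball (ENNReal.ofReal_le_ofReal hrδ)))]
    have hexp : ENNReal.ofReal (Real.exp (L * r)) ≤ ENNReal.ofReal (Real.exp (L' * r)) :=
      ENNReal.ofReal_le_ofReal (Real.exp_le_exp.2 (by gcongr))
    obtain ⟨h1, h2⟩ := hc r hr (hrδ.trans hδ) s hs hsm
    rw [heq]
    exact ⟨h1.trans (by gcongr), h2.trans (by gcongr)⟩

/-- Local inverse branches with locally uniform constants have uniform constants on a compact
space. -/
lemma exists_uniform_inverseBranch [CompactSpace X] (hf : Continuous f)
    (h : ∀ z₀, ∃ δ > 0, ∃ L, ∀ᶠ z in 𝓝 z₀, HasInverseBranch f a μ κ δ L z) {δ₀ : ℝ} (hδ₀ : 0 < δ₀) :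
    ∃ δ > 0, δ ≤ δ₀ ∧ ∃ L ≥ 0, ∀ z, HasInverseBranch f a μ κ δ L z := by
  choose δ hδ L hL using h
  obtain ⟨t, ht⟩ := CompactSpace.elim_nhds_subcover _ hL
  obtain ⟨δ', hδ', hδ'le⟩ : ∃ δ' > 0, δ' ≤ δ₀ ∧ ∀ z ∈ t, δ' ≤ δ z := by
    clear ht
    classical
    induction t using Finset.induction_on with
    | empty => exact ⟨δ₀, hδ₀, le_rfl, by simp⟩
    | insert z t _ ih =>
      obtain ⟨δ', h1, h2, h3⟩ := ih
      refine ⟨min δ' (δ z), lt_min h1 (hδ z), (min_le_left _ _).trans h2, fun y hy ↦ ?_⟩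
      rcases Finset.mem_insert.1 hy with rfl | hy
      · exact min_le_right _ _
      · exact (min_le_left _ _).trans (h3 y hy)
  obtain ⟨L', hL'⟩ := (t.finite_toSet.image L).bddAbove
  refine ⟨δ', hδ', hδ'le.1, max L' 0, le_max_right _ _, fun z ↦ ?_⟩
  have hz : z ∈ ⋃ y ∈ t, {x | HasInverseBranch f a μ κ (δ y) (L y) x} := by
    rw [ht]; trivial
  simp only [mem_iUnion] at hz
  obtain ⟨y, hy, hz⟩ := hz
  exact HasInverseBranch.mono hz hf hδ' (hδ'le.2 y hy)
    ((hL' (mem_image_of_mem _ hy)).trans (le_max_left _ _))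

/-- Hyperbolic preballs: the contraction and the bounded distortion at a hyperbolic time. -/
lemma exists_hyperbolic_preball [BorelSpace X] (hf : Continuous f) (ha : ∀ x, 0 ≤ a x)
    (hκ : 0 < κ) (hσ : 0 < σ) (hκσ : κ * σ < 1) (hδ : 0 < δ)
    (hloc : ∀ z, HasInverseBranch f a μ κ δ L z) (k : ℕ) :
    ∀ z, (∀ i ≤ k, ∏ j ∈ Finset.Ico i k, a (f^[j] z) ≤ σ ^ (k - i)) →
      ∃ V : Set X, IsOpen V ∧ z ∈ V ∧
        MapsTo f^[k] V (Metric.eball (f^[k] z) (ENNReal.ofReal δ)) ∧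
        SurjOn f^[k] V (Metric.eball (f^[k] z) (ENNReal.ofReal δ)) ∧
        (∀ v ∈ V, ∀ i ≤ k, edist (f^[i] v) (f^[i] z)
          ≤ ENNReal.ofReal (∏ j ∈ Finset.Ico i k, (κ * a (f^[j] z))) *
            edist (f^[k] v) (f^[k] z)) ∧
        ∃ c : ℝ≥0∞, ∀ s ⊆ Metric.eball (f^[k] z) (ENNReal.ofReal δ), MeasurableSet s →
          c * μ s ≤ ENNReal.ofReal (Real.exp (L * δ * ∑ i ∈ Finset.range k, (κ * σ) ^ i)) *
            μ (V ∩ f^[k] ⁻¹' s) ∧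
          μ (V ∩ f^[k] ⁻¹' s) ≤ ENNReal.ofReal
            (Real.exp (L * δ * ∑ i ∈ Finset.range k, (κ * σ) ^ i)) * (c * μ s) := by
  induction k with
  | zero =>
    intro z _
    refine ⟨Metric.eball z (ENNReal.ofReal δ), Metric.isOpen_eball,
      Metric.mem_eball_self (by simpa using hδ), fun v hv ↦ hv, fun v hv ↦ ⟨v, hv, rfl⟩,
      fun v _ i hi ↦ ?_, 1, fun s hs _ ↦ ?_⟩
    · obtain rfl : i = 0 := by omega
      simp
    · have : Metric.eball z (ENNReal.ofReal δ) ∩ s = s := inter_eq_self_of_subset_right hs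
      simp [this]
  | succ k ih =>
    intro z hz
    have hshift : ∀ (b : X → ℝ) (i : ℕ), ∏ j ∈ Finset.Ico (i + 1) (k + 1), b (f^[j] z)
        = ∏ j ∈ Finset.Ico i k, b (f^[j] (f z)) := fun b i ↦
      (Finset.prod_Ico_add' (fun j ↦ b (f^[j] z)) i k 1).symm
    have hz' : ∀ i ≤ k, ∏ j ∈ Finset.Ico i k, a (f^[j] (f z)) ≤ σ ^ (k - i) := fun i hi ↦ by
      have := hz (i + 1) (by omega)
      rwa [hshift, Nat.add_sub_add_right] at this
    -- The preball of `f z` for `k` steps is pulled back by the one-step branch at `z`.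
    -- Hyperbolicity passes to `f z` because its products all end at the same time.
    obtain ⟨V, hVo, hzV, hmaps, hsurj, hcontr, c, hc⟩ := ih (f z) hz'
    obtain ⟨U, hUo, hzU, hUmaps, hUsurj, hUcontr, c', hc'⟩ := hloc z
    have hprod : ∀ i ≤ k, ∏ j ∈ Finset.Ico i k, (κ * a (f^[j] (f z))) ≤ (κ * σ) ^ (k - i) := by
      intro i hi
      rw [Finset.prod_mul_distrib, Finset.prod_const, Nat.card_Ico, mul_pow]
      gcongr
      exact hz' i hi
    -- The preball already lies at scale `(κ * σ) ^ k * δ`, so the additional step has distortion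
    -- exponent `L * (κ * σ) ^ k * δ`, the next term of the geometric series.
    have hsmall : V ⊆ Metric.eball (f z) (ENNReal.ofReal ((κ * σ) ^ k * δ)) := by
      intro v hv
      have h1 := hcontr v hv 0 (Nat.zero_le _)
      have h2 : edist (f^[k] v) (f^[k] (f z)) < ENNReal.ofReal δ := hmaps hv
      have h3 : 0 < (κ * σ) ^ k := by positivity
      rw [Metric.mem_eball, ENNReal.ofReal_mul h3.le]
      refine h1.trans_lt ((mul_le_mul_left (ENNReal.ofReal_le_ofReal
        (by simpa using hprod 0 (Nat.zero_le _))) _).trans_lt ?_)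
      exact ENNReal.mul_lt_mul_right (by simpa using h3) ENNReal.ofReal_ne_top h2
    have hrle : (κ * σ) ^ k * δ ≤ δ :=
      mul_le_of_le_one_left hδ.le (pow_le_one₀ (by positivity) hκσ.le)
    refine ⟨U ∩ f ⁻¹' V, hUo.inter (hVo.preimage hf), ⟨hzU, hzV⟩, fun v hv ↦ hmaps hv.2,
      fun w hw ↦ ?_, fun v hv i hi ↦ ?_, c' * c, fun s hs hsm ↦ ?_⟩
    · obtain ⟨v, hv, rfl⟩ := hsurj hw
      obtain ⟨u, hu, rfl⟩ := hUsurj (Metric.eball_subset_eball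
        (ENNReal.ofReal_le_ofReal hrle) (hsmall hv))
      exact ⟨u, ⟨hu, hv⟩, rfl⟩
    · rcases i with _ | i
      · have h1 := hUcontr v hv.1
        have h2 := hcontr (f v) hv.2 0 (Nat.zero_le _)
        have h3 := hshift (fun x ↦ κ * a x) 0
        rw [Finset.prod_eq_prod_Ico_succ_bot (Nat.succ_pos k), h3, ENNReal.ofReal_mul
          (mul_nonneg hκ.le (ha _)), mul_assoc]
        exact h1.trans (mul_le_mul_right h2 _)
      · rw [hshift (fun x ↦ κ * a x) i]
        exact hcontr (f v) hv.2 i (by omega)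
    · have heq : U ∩ f ⁻¹' V ∩ f^[k + 1] ⁻¹' s = U ∩ f ⁻¹' (V ∩ f^[k] ⁻¹' s) := by
        rw [inter_assoc]; rfl
      have hs'm : MeasurableSet (V ∩ f^[k] ⁻¹' s) :=
        hVo.measurableSet.inter ((hf.iterate k).measurable hsm)
      obtain ⟨h1, h2⟩ := hc' _ (by positivity) hrle _ (inter_subset_left.trans hsmall) hs'm
      obtain ⟨h3, h4⟩ := hc s hs hsm
      have hexp : ENNReal.ofReal (Real.exp (L * δ * ∑ i ∈ Finset.range (k + 1), (κ * σ) ^ i))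
          = ENNReal.ofReal (Real.exp (L * ((κ * σ) ^ k * δ))) *
            ENNReal.ofReal (Real.exp (L * δ * ∑ i ∈ Finset.range k, (κ * σ) ^ i)) := by
        rw [← ENNReal.ofReal_mul (Real.exp_pos _).le, ← Real.exp_add, Finset.sum_range_succ]
        congr 2
        ring
      rw [heq, hexp]
      set e₁ := ENNReal.ofReal (Real.exp (L * ((κ * σ) ^ k * δ)))
      set e₂ := ENNReal.ofReal (Real.exp (L * δ * ∑ i ∈ Finset.range k, (κ * σ) ^ i))
      constructor
      · calc c' * c * μ s = c' * (c * μ s) := mul_assoc _ _ _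
          _ ≤ c' * (e₂ * μ (V ∩ f^[k] ⁻¹' s)) := by gcongr
          _ = e₂ * (c' * μ (V ∩ f^[k] ⁻¹' s)) := by ring
          _ ≤ e₂ * (e₁ * μ (U ∩ f ⁻¹' (V ∩ f^[k] ⁻¹' s))) := by gcongr
          _ = _ := by ring
      · calc _ ≤ e₁ * (c' * μ (V ∩ f^[k] ⁻¹' s)) := h2
          _ ≤ e₁ * (c' * (e₂ * (c * μ s))) := by gcongr
          _ = _ := by ring

/-- The measure of balls of a given radius is bounded below. -/
lemma exists_pos_le_measure_eball [CompactSpace X] [μ.IsOpenPosMeasure]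
    {r : ℝ≥0∞} (hr : 0 < r) : ∃ b : ℝ≥0∞, b ≠ 0 ∧ ∀ x, b ≤ μ (Metric.eball x r) := by
  have hr2 : 0 < r / 2 := ENNReal.half_pos hr.ne'
  obtain ⟨t, ht⟩ := CompactSpace.elim_nhds_subcover (fun x : X ↦ Metric.eball x (r / 2))
    fun x ↦ Metric.eball_mem_nhds x hr2
  refine ⟨t.inf fun x ↦ μ (Metric.eball x (r / 2)), ?_, fun x ↦ ?_⟩
  · rw [← pos_iff_ne_zero, Finset.lt_inf_iff (by simp)]
    exact fun x _ ↦ Metric.isOpen_eball.measure_pos μ ⟨x, Metric.mem_eball_self hr2⟩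
  · have hx : x ∈ ⋃ y ∈ t, Metric.eball y (r / 2) := by rw [ht]; trivial
    simp only [mem_iUnion] at hx
    obtain ⟨y, hy, hxy⟩ := hx
    refine (Finset.inf_le hy).trans (measure_mono fun w hw ↦ ?_)
    rw [Metric.mem_eball] at *
    calc edist w x ≤ edist w y + edist y x := edist_triangle _ _ _
      _ < r / 2 + r / 2 := ENNReal.add_lt_add hw (by rwa [edist_comm])
      _ = r := ENNReal.add_halves r

/-- The push-forward at hyperbolic times has bounded density. -/
theorem exists_domination_at_hyperbolicTime [CompactSpace X] [BorelSpace X] [IsFiniteMeasure μ]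
    [μ.IsOpenPosMeasure] (hf : Continuous f) (ha : ∀ x, 0 ≤ a x)
    (hκ : 0 < κ) (hσ : 0 < σ) (hκσ : κ * σ < 1) (hδ : 0 < δ) (hL : 0 ≤ L)
    (hloc : ∀ z, HasInverseBranch f a μ κ δ L z)
    (hinj : ∀ u v, edist u v < ENNReal.ofReal (3 * δ) → f u = f v → u = v) :
    ∃ C : ℝ≥0∞, C ≠ ⊤ ∧ ∀ (n : ℕ) (s : Set X), MeasurableSet s →
      μ ({x | IsCocycleHyperbolicTime f a σ n x} ∩ f^[n] ⁻¹' s) ≤ C * μ s := by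
  obtain ⟨b, hb0, hb⟩ := exists_pos_le_measure_eball (μ := μ) (r := ENNReal.ofReal (δ / 4))
    (by simpa using by positivity)
  set e : ℝ≥0∞ := ENNReal.ofReal (Real.exp (L * δ * (1 - κ * σ)⁻¹))
  have hele : ∀ k, ENNReal.ofReal (Real.exp (L * δ * ∑ i ∈ Finset.range k, (κ * σ) ^ i)) ≤ e := by
    intro k
    refine ENNReal.ofReal_le_ofReal (Real.exp_le_exp.2 ?_)
    gcongr
    rw [← tsum_geometric_of_lt_one (by positivity) hκσ]
    exact (summable_geometric_of_lt_one (by positivity) hκσ).sum_le_tsum _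
      fun i _ ↦ by positivity
  refine ⟨e * (e * (b⁻¹ * μ univ)), ?_, fun n s hs ↦ ?_⟩
  · exact ENNReal.mul_ne_top ENNReal.ofReal_ne_top (ENNReal.mul_ne_top ENNReal.ofReal_ne_top
      (ENNReal.mul_ne_top (ENNReal.inv_ne_top.2 hb0) (measure_ne_top _ _)))
  set H : Set X := {x | IsCocycleHyperbolicTime f a σ n x}
  have hV : ∀ z : X, ∃ V : Set X, z ∈ H → IsOpen V ∧ z ∈ V ∧
        MapsTo f^[n] V (Metric.eball (f^[n] z) (ENNReal.ofReal δ)) ∧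
        SurjOn f^[n] V (Metric.eball (f^[n] z) (ENNReal.ofReal δ)) ∧
        (∀ v ∈ V, ∀ i ≤ n, edist (f^[i] v) (f^[i] z) < ENNReal.ofReal δ) ∧
        ∃ c : ℝ≥0∞, ∀ s ⊆ Metric.eball (f^[n] z) (ENNReal.ofReal δ), MeasurableSet s →
          c * μ s ≤ e * μ (V ∩ f^[n] ⁻¹' s) ∧ μ (V ∩ f^[n] ⁻¹' s) ≤ e * (c * μ s) := by
    intro z
    by_cases hz : z ∈ H
    · have hz' : IsCocycleHyperbolicTime f a σ n z := hz
      obtain ⟨V, h1, h2, h3, h4, h5, c, h6⟩ := exists_hyperbolic_preball hf ha hκ hσ hκσ hδ hloc n z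
        fun i hi ↦ hz'.prod_le hi
      refine ⟨V, fun _ ↦ ⟨h1, h2, h3, h4, fun v hv i hi ↦ ?_, c, fun s hs hsm ↦
        ⟨(h6 s hs hsm).1.trans (mul_le_mul_left (hele n) _),
          (h6 s hs hsm).2.trans (mul_le_mul_left (hele n) _)⟩⟩⟩
      have hle : ∏ j ∈ Finset.Ico i n, (κ * a (f^[j] z)) ≤ 1 := by
        rw [Finset.prod_mul_distrib, Finset.prod_const, Nat.card_Ico]
        calc κ ^ (n - i) * ∏ j ∈ Finset.Ico i n, a (f^[j] z) ≤ κ ^ (n - i) * σ ^ (n - i) := by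
              gcongr
              exact hz'.prod_le hi
          _ ≤ 1 := by
              rw [← mul_pow]
              exact pow_le_one₀ (by positivity) hκσ.le
      calc edist (f^[i] v) (f^[i] z) ≤ _ := h5 v hv i hi
        _ ≤ 1 * edist (f^[n] v) (f^[n] z) := by
            gcongr
            simpa using hle
        _ < ENNReal.ofReal δ := by simpa using h3 hv
    · exact ⟨∅, fun h ↦ absurd h hz⟩
  choose V hV using hV
  choose! hVo hzV hmaps hsurj hclose c hc using hV
  -- The cores `W z` lie over balls of radius `δ / 4`: if two cores meet, the centre of one lies in
  -- the full preball of the other.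
  set W : X → Set X := fun z ↦ V z ∩ f^[n] ⁻¹' Metric.eball (f^[n] z) (ENNReal.ofReal (δ / 4))
    with hW
  have hWo : ∀ z ∈ H, IsOpen (W z) := fun z hz ↦
    (hVo z hz).inter (Metric.isOpen_eball.preimage (hf.iterate n))
  have hzW : ∀ z ∈ H, z ∈ W z := fun z hz ↦
    ⟨hzV z hz, Metric.mem_eball_self (by simpa using by positivity)⟩
  -- With the constant size function 0, the Vitali lemma simply supplies a disjoint subfamily of
  -- cores that meets every core.
  obtain ⟨u, huH, hudisj, hucov⟩ := Vitali.exists_disjoint_subfamily_covering_enlargement W H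
    (fun _ ↦ 0) 2 one_lt_two (fun _ _ ↦ le_rfl) 0 (fun _ _ ↦ le_rfl) fun z hz ↦ ⟨z, hzW z hz⟩
  have hengulf : ∀ x ∈ H, ∃ y ∈ u, x ∈ V y := by
    intro x hx
    obtain ⟨y, hy, ⟨p, hpx, hpy⟩, -⟩ := hucov x hx
    have hyH := huH hy
    refine ⟨y, hy, ?_⟩
    have hxy : edist (f^[n] x) (f^[n] y) < ENNReal.ofReal δ := by
      calc edist (f^[n] x) (f^[n] y) ≤ edist (f^[n] p) (f^[n] x) + edist (f^[n] p) (f^[n] y) :=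
            edist_triangle_left _ _ _
        _ < ENNReal.ofReal (δ / 4) + ENNReal.ofReal (δ / 4) := ENNReal.add_lt_add hpx.2 hpy.2
        _ ≤ ENNReal.ofReal δ := by
            rw [← ENNReal.ofReal_add (by positivity) (by positivity)]
            exact ENNReal.ofReal_le_ofReal (by linarith)
    obtain ⟨q, hq, hqx⟩ := hsurj y hyH hxy
    -- The orbits of `q` and `x` agree at time `n`. At each earlier time they are within `3 * δ`,
    -- through `y` and the common point `p`, so injectivity at that scale propagates the equality
    -- back to time 0.
    have hback : ∀ i ≤ n, f^[n - i] q = f^[n - i] x := by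
      intro i
      induction i with
      | zero => exact fun _ ↦ hqx
      | succ i ih =>
        intro hi
        have h1 := ih (by omega)
        rw [show n - i = (n - (i + 1)) + 1 by omega, Function.iterate_succ_apply',
          Function.iterate_succ_apply'] at h1
        refine hinj _ _ ?_ h1
        set j := n - (i + 1)
        have hjn : j ≤ n := by omega
        calc edist (f^[j] q) (f^[j] x)
            ≤ edist (f^[j] q) (f^[j] y) + edist (f^[j] y) (f^[j] p) + edist (f^[j] p) (f^[j] x) :=
              edist_triangle4 _ _ _ _
          _ < ENNReal.ofReal δ + ENNReal.ofReal δ + ENNReal.ofReal δ := by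
              refine ENNReal.add_lt_add (ENNReal.add_lt_add (hclose y hyH q hq j hjn) ?_)
                (hclose x hx p hpx.1 j hjn)
              rw [edist_comm]
              exact hclose y hyH p hpy.1 j hjn
          _ = ENNReal.ofReal (3 * δ) := by
              rw [← ENNReal.ofReal_add (by positivity) (by positivity),
                ← ENNReal.ofReal_add (by positivity) (by positivity)]
              congr 1
              ring
    have := hback n le_rfl
    simp only [Nat.sub_self, Function.iterate_zero, id] at this
    exact this ▸ hq
  have hucount : u.Countable := hudisj.countable_of_isOpen (fun z hz ↦ hWo z (huH hz))
    fun z hz ↦ ⟨z, hzW z (huH hz)⟩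
  -- The reference Jacobian is bounded by the measure of the core, since the core covers a ball of
  -- measure at least `b`. Disjointness of the cores then makes the sum of the Jacobians finite.
  have hcW : ∀ y ∈ u, c y ≤ e * (b⁻¹ * μ (W y)) := by
    intro y hy
    have h1 := (hc y (huH hy) _ (Metric.eball_subset_eball (ENNReal.ofReal_le_ofReal
      (show δ / 4 ≤ δ by linarith))) Metric.isOpen_eball.measurableSet).1
    have h2 : c y * b ≤ e * μ (W y) := (mul_le_mul_right (hb (f^[n] y)) _).trans h1
    have hbtop : b ≠ ⊤ := ne_top_of_le_ne_top (measure_ne_top μ _) (hb y)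
    calc c y = c y * b * b⁻¹ := by rw [mul_assoc, ENNReal.mul_inv_cancel hb0 hbtop, mul_one]
      _ ≤ e * μ (W y) * b⁻¹ := by gcongr
      _ = _ := by ring
  have hVs : ∀ y ∈ u, μ (V y ∩ f^[n] ⁻¹' s) ≤ e * (c y * μ s) := by
    intro y hy
    have heq : V y ∩ f^[n] ⁻¹' s
        = V y ∩ f^[n] ⁻¹' (s ∩ Metric.eball (f^[n] y) (ENNReal.ofReal δ)) := by
      ext v
      simp only [mem_inter_iff, mem_preimage]
      exact ⟨fun h ↦ ⟨h.1, h.2, hmaps y (huH hy) h.1⟩, fun h ↦ ⟨h.1, h.2.1⟩⟩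
    rw [heq]
    refine (hc y (huH hy) _ inter_subset_right
      (hs.inter Metric.isOpen_eball.measurableSet)).2.trans ?_
    gcongr
    exact inter_subset_left
  have := hucount.to_subtype
  calc μ (H ∩ f^[n] ⁻¹' s) ≤ μ (⋃ y : u, V y ∩ f^[n] ⁻¹' s) := by
        refine measure_mono fun x hx ↦ ?_
        obtain ⟨y, hy, hxy⟩ := hengulf x hx.1
        exact mem_iUnion.2 ⟨⟨y, hy⟩, hxy, hx.2⟩
    _ ≤ ∑' y : u, μ (V y ∩ f^[n] ⁻¹' s) := measure_iUnion_le _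
    _ ≤ ∑' y : u, e * ((e * (b⁻¹ * μ (W y))) * μ s) := by
        refine ENNReal.tsum_le_tsum fun y ↦ (hVs y y.2).trans ?_
        gcongr
        exact hcW y y.2
    _ = e * ((e * (b⁻¹ * ∑' y : u, μ (W y))) * μ s) := by
        rw [ENNReal.tsum_mul_left, ENNReal.tsum_mul_right, ENNReal.tsum_mul_left,
          ENNReal.tsum_mul_left]
    _ ≤ e * ((e * (b⁻¹ * μ univ)) * μ s) := by
        gcongr
        rw [← measure_biUnion hucount hudisj fun y hy ↦ (hWo y (huH hy)).measurableSet]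
        exact measure_mono (subset_univ _)
    _ = e * (e * (b⁻¹ * μ univ)) * μ s := by ring

end Preballs

/-! ### Continuity of operator norms in a Riemannian bundle. -/

section OperatorNorm

variable {B : Type*} [TopologicalSpace B] {F : Type*} [NormedAddCommGroup F] [NormedSpace ℝ F]
  {V : B → Type*} [TopologicalSpace (TotalSpace F V)] [∀ x, NormedAddCommGroup (V x)]
  [∀ x, InnerProductSpace ℝ (V x)] [FiberBundle F V] [VectorBundle ℝ F V]
  [IsContinuousRiemannianBundle F V]

/-- The operator norm of a continuous family of linear maps between the fibers of a Riemannian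
bundle is continuous. -/
lemma continuousAt_opNorm_of_inCoordinates {N : Type*} [TopologicalSpace N] {b b' : N → B}
    {ϕ : ∀ x, V (b x) →L[ℝ] V (b' x)} {x₀ : N} (hb : ContinuousAt b x₀) (hb' : ContinuousAt b' x₀)
    (hϕ : ContinuousAt (fun x ↦ ContinuousLinearMap.inCoordinates F V F V
      (b x₀) (b x) (b' x₀) (b' x) (ϕ x)) x₀) :
    ContinuousAt (fun x ↦ ‖ϕ x‖) x₀ := by
  set e := trivializationAt F V (b x₀) with he
  set e' := trivializationAt F V (b' x₀)
  set T : N → F →L[ℝ] F := fun x ↦ ContinuousLinearMap.inCoordinates F V F V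
      (b x₀) (b x) (b' x₀) (b' x) (ϕ x) with hT
  -- `A x` is `ϕ x` carried by the trivializations to the fixed fibers over `b x₀` and `b' x₀`,
  -- where continuity is that of an ordinary norm. The trivializations distort norms by a factor
  -- arbitrarily close to 1 near the base point.
  set A : N → V (b x₀) →L[ℝ] V (b' x₀) := fun x ↦
    (e'.symmL ℝ (b' x₀) ∘L T x) ∘L e.continuousLinearMapAt ℝ (b x₀) with hA
  have hAc : ContinuousAt (fun x ↦ ‖A x‖) x₀ :=
    ((continuousAt_const.clm_comp hϕ).clm_comp continuousAt_const).norm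
  have hmem : ∀ᶠ x in 𝓝 x₀, b x ∈ e.baseSet :=
    hb.eventually (e.open_baseSet.mem_nhds (FiberBundle.mem_baseSet_trivializationAt' _))
  have hmem' : ∀ᶠ x in 𝓝 x₀, b' x ∈ e'.baseSet :=
    hb'.eventually (e'.open_baseSet.mem_nhds (FiberBundle.mem_baseSet_trivializationAt' _))
  have hmem₀ : b x₀ ∈ e.baseSet := FiberBundle.mem_baseSet_trivializationAt' _
  have hmem₀' : b' x₀ ∈ e'.baseSet := FiberBundle.mem_baseSet_trivializationAt' _
  have key : ∀ r : ℝ, 1 < r → ∀ᶠ x in 𝓝 x₀, ‖ϕ x‖ ≤ r * ‖A x‖ * r ∧ ‖A x‖ ≤ r * ‖ϕ x‖ * r := by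
    intro r hr
    have h1 := hb.eventually (eventually_norm_symmL_trivializationAt_self_comp_lt F V (b x₀) hr)
    have h2 := hb.eventually (eventually_norm_symmL_trivializationAt_comp_self_lt F V (b x₀) hr)
    have h3 := hb'.eventually (eventually_norm_symmL_trivializationAt_self_comp_lt F V (b' x₀) hr)
    have h4 := hb'.eventually (eventually_norm_symmL_trivializationAt_comp_self_lt F V (b' x₀) hr)
    filter_upwards [h1, h2, h3, h4, hmem, hmem'] with x h1 h2 h3 h4 hx hx'
    have hTx : T x = (e'.continuousLinearMapAt ℝ (b' x) ∘L ϕ x) ∘L e.symmL ℝ (b x) := rfl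
    have E1 : ϕ x = ((e'.symmL ℝ (b' x) ∘L e'.continuousLinearMapAt ℝ (b' x₀)) ∘L A x) ∘L
        (e.symmL ℝ (b x₀) ∘L e.continuousLinearMapAt ℝ (b x)) := by
      ext v
      simp only [hA, hTx, ContinuousLinearMap.comp_apply]
      rw [e.continuousLinearMapAt_symmL hmem₀, e.symmL_continuousLinearMapAt hx,
        e'.continuousLinearMapAt_symmL hmem₀', e'.symmL_continuousLinearMapAt hx']
    have E2 : A x = ((e'.symmL ℝ (b' x₀) ∘L e'.continuousLinearMapAt ℝ (b' x)) ∘L ϕ x) ∘L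
        (e.symmL ℝ (b x) ∘L e.continuousLinearMapAt ℝ (b x₀)) := by
      ext v
      simp only [hA, hTx, ContinuousLinearMap.comp_apply]
    constructor
    · rw [E1]
      refine (ContinuousLinearMap.opNorm_comp_le _ _).trans ?_
      refine mul_le_mul ((ContinuousLinearMap.opNorm_comp_le _ _).trans ?_) h1.le (norm_nonneg _)
        (by positivity)
      exact mul_le_mul_of_nonneg_right h4.le (norm_nonneg _)
    · rw [E2]
      refine (ContinuousLinearMap.opNorm_comp_le _ _).trans ?_
      refine mul_le_mul ((ContinuousLinearMap.opNorm_comp_le _ _).trans ?_) h2.le (norm_nonneg _)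
        (by positivity)
      exact mul_le_mul_of_nonneg_right h3.le (norm_nonneg _)
  have hA₀ : A x₀ = ϕ x₀ := by
    ext v
    simp only [hA, hT, ContinuousLinearMap.inCoordinates, ContinuousLinearMap.comp_apply]
    rw [e.symmL_continuousLinearMapAt hmem₀, e'.symmL_continuousLinearMapAt hmem₀']
  have hAc' : Tendsto (fun x ↦ ‖A x‖) (𝓝 x₀) (𝓝 ‖ϕ x₀‖) := hA₀ ▸ hAc
  have hsq : Tendsto (fun r : ℝ ↦ r * ‖ϕ x₀‖ * r) (𝓝[>] 1) (𝓝 ‖ϕ x₀‖) := by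
    have : Tendsto (fun r : ℝ ↦ r * ‖ϕ x₀‖ * r) (𝓝 1) (𝓝 (1 * ‖ϕ x₀‖ * 1)) :=
      Continuous.tendsto (by fun_prop) 1
    simpa using this.mono_left nhdsWithin_le_nhds
  have hsq' : Tendsto (fun r : ℝ ↦ ‖ϕ x₀‖ / (r * r)) (𝓝[>] 1) (𝓝 ‖ϕ x₀‖) := by
    have : Tendsto (fun r : ℝ ↦ ‖ϕ x₀‖ / (r * r)) (𝓝 1) (𝓝 (‖ϕ x₀‖ / (1 * 1))) :=
      ContinuousAt.tendsto (ContinuousAt.div (by fun_prop) (by fun_prop) (by norm_num))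
    simpa using this.mono_left nhdsWithin_le_nhds
  rw [ContinuousAt, tendsto_order]
  constructor
  · intro c hc
    obtain ⟨r, hrc, hr1⟩ := ((hsq'.eventually (lt_mem_nhds hc)).and self_mem_nhdsWithin).exists
    have hr1 : 1 < r := hr1
    have h5 : Tendsto (fun x ↦ ‖A x‖ / (r * r)) (𝓝 x₀) (𝓝 (‖ϕ x₀‖ / (r * r))) :=
      hAc'.div_const _
    filter_upwards [key r hr1, h5.eventually (lt_mem_nhds hrc)] with x hx hx'
    refine hx'.trans_le ?_
    rw [div_le_iff₀ (by positivity)]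
    linarith [hx.2]
  · intro c hc
    obtain ⟨r, hrc, hr1⟩ := ((hsq.eventually (gt_mem_nhds hc)).and self_mem_nhdsWithin).exists
    have hr1 : 1 < r := hr1
    have h5 : Tendsto (fun x ↦ r * ‖A x‖ * r) (𝓝 x₀) (𝓝 (r * ‖ϕ x₀‖ * r)) :=
      (hAc'.const_mul _).mul_const _
    filter_upwards [key r hr1, h5.eventually (gt_mem_nhds hrc)] with x hx hx'
    exact hx.1.trans_lt hx'

end OperatorNorm

section Riemannian

variable {d : ℕ} {M : Type*} [TopologicalSpace M]
    [ChartedSpace (EuclideanSpace ℝ (Fin d)) M] [IsManifold (𝓡 d) ∞ M]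
    [RiemannianBundle (fun x : M ↦ TangentSpace (𝓡 d) x)]
    [IsContMDiffRiemannianBundle (𝓡 d) ∞ (EuclideanSpace ℝ (Fin d))
      (fun x : M ↦ TangentSpace (𝓡 d) x)]

instance isContinuousRiemannianBundle_of_contMDiff :
    IsContinuousRiemannianBundle (EuclideanSpace ℝ (Fin d))
      (fun x : M ↦ TangentSpace (𝓡 d) x) := by
  obtain ⟨g, hg, hg'⟩ := IsContMDiffRiemannianBundle.exists_contMDiff (IB := 𝓡 d) (n := ∞)
    (F := EuclideanSpace ℝ (Fin d)) (E := fun x : M ↦ TangentSpace (𝓡 d) x)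
  exact ⟨⟨g, hg.continuous, hg'⟩⟩

lemma continuousAt_opNorm_mfderiv {h : M → M} {x₀ : M} (hh : ContMDiffAt (𝓡 d) (𝓡 d) 1 h x₀) :
    ContinuousAt (fun x ↦ ‖mfderiv (𝓡 d) (𝓡 d) h x‖) x₀ := by
  have : IsManifold (𝓡 d) 1 M := IsManifold.of_le (n := ∞) (by norm_num)
  have h0 := (hh.mfderiv_const (m := 0) (by norm_num)).continuousAt
  exact continuousAt_opNorm_of_inCoordinates (F := EuclideanSpace ℝ (Fin d))
    (V := fun x : M ↦ TangentSpace (𝓡 d) x) (b := id) (b' := h)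
    (ϕ := fun x ↦ mfderiv (𝓡 d) (𝓡 d) h x) continuousAt_id hh.continuousAt h0

end Riemannian

/-! ### A mean value inequality for the Riemannian distance. -/

section Lipschitz

variable {E : Type*} [NormedAddCommGroup E] [NormedSpace ℝ E] {H : Type*} [TopologicalSpace H]
  {I : ModelWithCorners ℝ E H} {M : Type*} [PseudoEMetricSpace M] [ChartedSpace H M]
  [RiemannianBundle (fun x : M ↦ TangentSpace I x)] [IsRiemannianManifold I M]
  {E' : Type*} [NormedAddCommGroup E'] [NormedSpace ℝ E'] {H' : Type*} [TopologicalSpace H']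
  {I' : ModelWithCorners ℝ E' H'} {M' : Type*} [PseudoEMetricSpace M'] [ChartedSpace H' M']
  [RiemannianBundle (fun x : M' ↦ TangentSpace I' x)] [IsRiemannianManifold I' M']

/-- The mean value inequality on balls of a Riemannian manifold, with one point at the center. -/
lemma edist_image_le_of_enorm_mfderiv_le [IsManifold I 1 M] [IsManifold I' 1 M']
    [IsContinuousRiemannianBundle E (fun x : M ↦ TangentSpace I x)]
    [IsContinuousRiemannianBundle E' (fun x : M' ↦ TangentSpace I' x)] {h : M → M'} {x : M}
    {R : ℝ≥0∞} {K : NNReal} (hh : ∀ w ∈ Metric.eball x R, ContMDiffAt I I' 1 h w)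
    (hK : ∀ w ∈ Metric.eball x R, ‖mfderiv I I' h w‖ₑ ≤ K) {y : M} (hy : y ∈ Metric.eball x R) :
    edist (h y) (h x) ≤ K * edist y x := by
  have hmain : ∀ r, edist x y < r → r ≤ R → edist (h x) (h y) ≤ K * r := by
    intro r hr hrR
    rw [IsRiemannianManifold.out (I := I) x y] at hr
    obtain ⟨γ, hγ0, hγ1, hγ, hlen⟩ := Manifold.exists_lt_of_riemannianEDist_lt hr
    -- A curve from the centre of length less than `R` cannot leave the ball. Taking one point at
    -- the centre thus avoids any convexity of balls.
    have hmem : ∀ t ∈ Icc (0 : ℝ) 1, γ t ∈ Metric.eball x R := by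
      intro t ht
      rw [Metric.mem_eball, edist_comm, IsRiemannianManifold.out (I := I) x (γ t)]
      calc Manifold.riemannianEDist I x (γ t) ≤ Manifold.pathELength I γ 0 t :=
            Manifold.riemannianEDist_le_pathELength
              (hγ.mono (Icc_subset_Icc_right ht.2)) hγ0 rfl ht.1
        _ ≤ Manifold.pathELength I γ 0 1 := Manifold.pathELength_mono le_rfl ht.2
        _ < r := hlen
        _ ≤ R := hrR
    have hhγ : ContMDiffOn 𝓘(ℝ) I' 1 (h ∘ γ) (Icc 0 1) := fun t ht ↦
      (hh (γ t) (hmem t ht)).comp_contMDiffWithinAt t (hγ t ht)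
    rw [IsRiemannianManifold.out (I := I') (h x) (h y)]
    calc Manifold.riemannianEDist I' (h x) (h y) ≤ Manifold.pathELength I' (h ∘ γ) 0 1 :=
          Manifold.riemannianEDist_le_pathELength hhγ (by simp [hγ0]) (by simp [hγ1]) zero_le_one
      _ = ∫⁻ t in Icc (0 : ℝ) 1, ‖mfderivWithin 𝓘(ℝ) I' (h ∘ γ) (Icc 0 1) t 1‖ₑ :=
          Manifold.pathELength_eq_lintegral_mfderivWithin_Icc
      _ ≤ ∫⁻ t in Icc (0 : ℝ) 1, K * ‖mfderivWithin 𝓘(ℝ) I γ (Icc 0 1) t 1‖ₑ := by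
          refine setLIntegral_mono' measurableSet_Icc fun t ht ↦ ?_
          have hcomp : mfderivWithin 𝓘(ℝ) I' (h ∘ γ) (Icc 0 1) t =
              (mfderiv I I' h (γ t)) ∘L (mfderivWithin 𝓘(ℝ) I γ (Icc 0 1) t) := by
            apply mfderiv_comp_mfderivWithin
            · exact (hh (γ t) (hmem t ht)).mdifferentiableAt one_ne_zero
            · exact (hγ t ht).mdifferentiableWithinAt one_ne_zero
            · rw [uniqueMDiffWithinAt_iff_uniqueDiffWithinAt]
              exact uniqueDiffOn_Icc zero_lt_one t ht
          have hcomp1 : mfderivWithin 𝓘(ℝ) I' (h ∘ γ) (Icc 0 1) t 1 =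
              (mfderiv I I' h (γ t)) (mfderivWithin 𝓘(ℝ) I γ (Icc 0 1) t 1) :=
            congr($hcomp 1)
          rw [hcomp1]
          refine (ContinuousLinearMap.le_opENorm _ _).trans ?_
          gcongr
          exact hK _ (hmem t ht)
      _ = K * Manifold.pathELength I γ 0 1 := by
          rw [lintegral_const_mul' _ _ ENNReal.coe_ne_top,
            Manifold.pathELength_eq_lintegral_mfderivWithin_Icc]
      _ ≤ K * r := by gcongr
  rw [Metric.mem_eball, edist_comm] at hy
  rw [edist_comm (h y), edist_comm y]
  have := nhdsGT_neBot_of_exists_gt ⟨R, hy⟩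
  refine ge_of_tendsto (f := fun r : ℝ≥0∞ ↦ (K : ℝ≥0∞) * r) (x := 𝓝[>] edist x y) ?_ ?_
  · exact (ENNReal.Tendsto.const_mul tendsto_id (Or.inr ENNReal.coe_ne_top)).mono_left
      nhdsWithin_le_nhds
  · filter_upwards [Ioo_mem_nhdsGT hy] with r hr
    exact hmain r hr.1 hr.2.le

end Lipschitz

/-! ### The volume density: positivity, smoothness and change of charts. -/

section Density

variable {d : ℕ} {M : Type*} [TopologicalSpace M]
    [ChartedSpace (EuclideanSpace ℝ (Fin d)) M]

lemma chart_mdifferentiable [IsManifold (𝓡 d) ∞ M]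
    {φ : OpenPartialHomeomorph M (EuclideanSpace ℝ (Fin d))}
    (hφ : φ ∈ atlas (EuclideanSpace ℝ (Fin d)) M) :
    φ.MDifferentiable (𝓡 d) (𝓡 d) :=
  have : IsManifold (𝓡 d) 1 M := IsManifold.of_le (n := ∞) (by norm_num)
  mdifferentiable_of_mem_atlas hφ

variable [RiemannianBundle (fun x : M ↦ TangentSpace (𝓡 d) x)]

/-- The Riemannian metric at `p`, as a form on the model space. -/
noncomputable def metricForm (p : M) (u v : EuclideanSpace ℝ (Fin d)) : ℝ :=
  inner ℝ (show TangentSpace (𝓡 d) p from u) (show TangentSpace (𝓡 d) p from v)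

lemma metricForm_sum_sum (p : M) (b : Fin d → EuclideanSpace ℝ (Fin d)) (s t : Fin d → ℝ) :
    metricForm p (∑ k, s k • b k) (∑ l, t l • b l)
      = ∑ k, ∑ l, s k * metricForm p (b k) (b l) * t l := by
  have h := sum_inner (𝕜 := ℝ) (E := TangentSpace (𝓡 d) p) Finset.univ
    (fun k ↦ s k • (show TangentSpace (𝓡 d) p from b k))
    (∑ l, t l • (show TangentSpace (𝓡 d) p from b l))
  refine h.trans ?_
  refine Finset.sum_congr rfl fun k _ ↦ ?_
  rw [inner_sum]
  refine Finset.sum_congr rfl fun l _ ↦ ?_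
  rw [inner_smul_left, inner_smul_right]
  simp only [metricForm, RCLike.conj_to_real]
  ring

/-- In `metricForm` the base point is an explicit argument and the vectors lie in the model space,
so equal base points can be exchanged by rewriting. -/
lemma gram_coordVector_apply (φ : OpenPartialHomeomorph M (EuclideanSpace ℝ (Fin d)))
    (y : EuclideanSpace ℝ (Fin d)) (i j : Fin d) :
    Matrix.gram ℝ (coordVector φ y) i j = metricForm (φ.symm y)
      (mfderiv (𝓡 d) (𝓡 d) φ.symm y (EuclideanSpace.single i (1 : ℝ)))
      (mfderiv (𝓡 d) (𝓡 d) φ.symm y (EuclideanSpace.single j (1 : ℝ))) := rfl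

variable {φ ψ : OpenPartialHomeomorph M (EuclideanSpace ℝ (Fin d))}

variable [IsManifold (𝓡 d) ∞ M]

lemma volumeDensity_pos (hφ : φ ∈ atlas (EuclideanSpace ℝ (Fin d)) M)
    {y : EuclideanSpace ℝ (Fin d)} (hy : y ∈ φ.target) : 0 < volumeDensity φ y := by
  refine Real.sqrt_pos.2 (Matrix.PosDef.det_pos (Matrix.posDef_gram_of_linearIndependent ?_))
  have h1 : LinearIndependent ℝ fun i : Fin d ↦ EuclideanSpace.single i (1 : ℝ) := by
    have h := (EuclideanSpace.basisFun (Fin d) ℝ).toBasis.linearIndependent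
    have heq : ⇑(EuclideanSpace.basisFun (Fin d) ℝ).toBasis
        = fun i : Fin d ↦ EuclideanSpace.single i (1 : ℝ) := by
      ext1 i
      simp
    rwa [heq] at h
  have h2 := (chart_mdifferentiable hφ).symm.ker_mfderiv_eq_bot hy
  exact h1.map' (mfderiv (𝓡 d) (𝓡 d) φ.symm y).toLinearMap h2

lemma contDiffOn_det_gram_coordVector [IsContMDiffRiemannianBundle (𝓡 d) ∞
    (EuclideanSpace ℝ (Fin d)) (fun x : M ↦ TangentSpace (𝓡 d) x)]
    (hφ : φ ∈ atlas (EuclideanSpace ℝ (Fin d)) M) :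
    ContDiffOn ℝ 1 (fun y ↦ (Matrix.gram ℝ (coordVector φ y)).det) φ.target := by
  have : IsManifold (𝓡 d) 1 M := IsManifold.of_le (n := ∞) (by norm_num)
  have : IsManifold (𝓡 d) 2 M := IsManifold.of_le (n := ∞) ENat.LEInfty.out
  have hsec : ∀ i : Fin d, ContMDiffOn (𝓡 d) ((𝓡 d).prod (𝓡 d)) 1
      (fun y ↦ (⟨φ.symm y, coordVector φ y i⟩ :
        TotalSpace (EuclideanSpace ℝ (Fin d)) (fun x : M ↦ TangentSpace (𝓡 d) x))) φ.target := by
    intro i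
    have h1 : ContMDiffOn (𝓡 d) (𝓡 d) 2 φ.symm φ.target :=
      contMDiffOn_symm_of_mem_maximalAtlas
        (IsManifold.subset_maximalAtlas hφ)
    have h2 := h1.contMDiffOn_tangentMapWithin (m := 1) (by norm_num) φ.open_target.uniqueMDiffOn
    have h3 : ContMDiffOn (𝓡 d) ((𝓡 d).prod (𝓡 d)) 1
        (fun y : EuclideanSpace ℝ (Fin d) ↦ (⟨y, EuclideanSpace.single i (1 : ℝ)⟩ :
          TangentBundle (𝓡 d) (EuclideanSpace ℝ (Fin d)))) φ.target :=
      contMDiffOn_vectorSpace_iff_contDiffOn.2 contDiffOn_const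
    refine (h2.comp h3 fun y hy ↦ hy).congr fun y hy ↦ ?_
    simp only [Function.comp_apply, tangentMapWithin]
    rw [mfderivWithin_of_isOpen φ.open_target hy]
    rfl
  have hentry : ∀ i j : Fin d,
      ContDiffOn ℝ 1 (fun y ↦ Matrix.gram ℝ (coordVector φ y) i j) φ.target := by
    intro i j
    have : IsContMDiffRiemannianBundle (𝓡 d) 1
      (EuclideanSpace ℝ (Fin d)) (fun x : M ↦ TangentSpace (𝓡 d) x) :=
      IsContMDiffRiemannianBundle.of_le (n := ∞) (by norm_num)
    exact (ContMDiffOn.inner_bundle (hsec i) (hsec j)).contDiffOn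
  simp only [Matrix.det_apply]
  refine ContDiffOn.sum fun σ _ ↦ ContDiffOn.const_smul _ (contDiffOn_prod fun i _ ↦ hentry _ _)

lemma contDiffOn_volumeDensity [IsContMDiffRiemannianBundle (𝓡 d) ∞
    (EuclideanSpace ℝ (Fin d)) (fun x : M ↦ TangentSpace (𝓡 d) x)]
    (hφ : φ ∈ atlas (EuclideanSpace ℝ (Fin d)) M) :
    ContDiffOn ℝ 1 (volumeDensity φ) φ.target :=
  (contDiffOn_det_gram_coordVector hφ).sqrt fun _ hy ↦
    (Real.sqrt_pos.1 (volumeDensity_pos hφ hy)).ne'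

/-- The transformation of the volume density under a change of charts. -/
lemma volumeDensity_eq_abs_det_mul (hφ : φ ∈ atlas (EuclideanSpace ℝ (Fin d)) M)
    (hψ : ψ ∈ atlas (EuclideanSpace ℝ (Fin d)) M) {y : EuclideanSpace ℝ (Fin d)}
    (hy : y ∈ (ψ.symm.trans φ).source) :
    volumeDensity ψ y = |(fderiv ℝ (φ ∘ ψ.symm) y).det| * volumeDensity φ (φ (ψ.symm y)) := by
  have hyψ : y ∈ ψ.target := by simpa using hy.1
  have hyφ : ψ.symm y ∈ φ.source := hy.2
  set T : EuclideanSpace ℝ (Fin d) → EuclideanSpace ℝ (Fin d) := φ ∘ ψ.symm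
  set A : EuclideanSpace ℝ (Fin d) →L[ℝ] EuclideanSpace ℝ (Fin d) := fderiv ℝ T y
  have hTd : MDifferentiableAt (𝓡 d) (𝓡 d) T y :=
    ((chart_mdifferentiable hφ).mdifferentiableAt hyφ).comp y
      ((chart_mdifferentiable hψ).mdifferentiableAt_symm hyψ)
  have hev : ψ.symm =ᶠ[𝓝 y] φ.symm ∘ T := by
    filter_upwards [(ψ.symm.trans φ).open_source.mem_nhds hy] with z hz
    exact (φ.left_inv hz.2).symm
  have hpt : ψ.symm y = φ.symm (T y) := (φ.left_inv hyφ).symm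
  set D : EuclideanSpace ℝ (Fin d) →L[ℝ] EuclideanSpace ℝ (Fin d) :=
    mfderiv (𝓡 d) (𝓡 d) φ.symm (T y) with hD
  have hder : ∀ v : EuclideanSpace ℝ (Fin d),
      (mfderiv (𝓡 d) (𝓡 d) ψ.symm y v : EuclideanSpace ℝ (Fin d)) = D (A v) := by
    intro v
    have h1 : HasMFDerivAt (𝓡 d) (𝓡 d) (φ.symm ∘ T) y
        ((mfderiv (𝓡 d) (𝓡 d) φ.symm (T y)).comp (mfderiv (𝓡 d) (𝓡 d) T y)) :=
      ((chart_mdifferentiable hφ).mdifferentiableAt_symm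
        (φ.map_source hyφ)).hasMFDerivAt.comp y hTd.hasMFDerivAt
    have h2 := (h1.congr_of_eventuallyEq hev).mfderiv
    rw [mfderiv_eq_fderiv] at h2
    exact congr($h2 v)
  set P := LinearMap.toMatrix (EuclideanSpace.basisFun (Fin d) ℝ).toBasis
    (EuclideanSpace.basisFun (Fin d) ℝ).toBasis A.toLinearMap with hP
  have hAe : ∀ j : Fin d, A (EuclideanSpace.single j (1 : ℝ))
      = ∑ k, P k j • EuclideanSpace.single k (1 : ℝ) := by
    intro j
    have := (EuclideanSpace.basisFun (Fin d) ℝ).toBasis.sum_repr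
      (A (EuclideanSpace.single j (1 : ℝ)))
    rw [← this]
    refine Finset.sum_congr rfl fun k _ ↦ ?_
    simp [hP, LinearMap.toMatrix_apply]
  -- The chain rule turns a change of charts into a congruence of Gram matrices; the square root of
  -- its determinant produces `|det P|`.
  have hgram : Matrix.gram ℝ (coordVector ψ y)
      = P.transpose * Matrix.gram ℝ (coordVector φ (T y)) * P := by
    ext i j
    rw [gram_coordVector_apply, hder, hder, hAe, hAe, hpt, map_sum, map_sum]
    simp only [map_smul]
    rw [metricForm_sum_sum]
    simp only [Matrix.mul_apply, Matrix.transpose_apply, gram_coordVector_apply, Finset.sum_mul]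
    rw [Finset.sum_comm]
    rfl
  have hdet : A.det = P.det := by
    rw [hP, LinearMap.det_toMatrix]
  rw [volumeDensity, hgram, Matrix.det_mul, Matrix.det_mul, Matrix.det_transpose, volumeDensity,
    hdet,
    show P.det * (Matrix.gram ℝ (coordVector φ (T y))).det * P.det
      = P.det ^ 2 * (Matrix.gram ℝ (coordVector φ (T y))).det by ring,
    Real.sqrt_mul (sq_nonneg _), Real.sqrt_sq_eq_abs]
  rfl

end Density

/-! ### The Riemannian volume in a chart; finiteness and positivity. -/

section Volume

lemma ContinuousOn.measurableSet_inter_preimage {X Y : Type*} [TopologicalSpace X]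
    [MeasurableSpace X] [OpensMeasurableSpace X] [TopologicalSpace Y] [MeasurableSpace Y]
    [BorelSpace Y] {g : X → Y} {t : Set X} (hg : ContinuousOn g t) (ht : MeasurableSet t)
    {s : Set Y} (hs : MeasurableSet s) : MeasurableSet (t ∩ g ⁻¹' s) := by
  have h1 := (continuousOn_iff_continuous_domRestrict.1 hg).measurable hs
  have h2 := ht.subtype_image h1
  convert h2 using 1
  ext x
  simp [and_comm]

variable {d : ℕ} {M : Type*} [TopologicalSpace M]
    [ChartedSpace (EuclideanSpace ℝ (Fin d)) M]
    [RiemannianBundle (fun x : M ↦ TangentSpace (𝓡 d) x)]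
    [MeasurableSpace M] [BorelSpace M]
    {φ ψ : OpenPartialHomeomorph M (EuclideanSpace ℝ (Fin d))}

lemma chartVolume_apply {s : Set M} (hs : MeasurableSet s) :
    chartVolume φ s = ∫⁻ y in φ.target ∩ φ.symm ⁻¹' s, ENNReal.ofReal (volumeDensity φ y) := by
  have hm : MeasurableSet (φ.target ∩ φ.symm ⁻¹' s) :=
    ContinuousOn.measurableSet_inter_preimage φ.continuousOn_symm φ.open_target.measurableSet hs
  have hae : AEMeasurable φ.symm
      (((volume : Measure (EuclideanSpace ℝ (Fin d))).restrict φ.target).withDensity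
        (fun y ↦ ENNReal.ofReal (volumeDensity φ y))) :=
    (φ.continuousOn_symm.aemeasurable φ.open_target.measurableSet).mono_ac
      (withDensity_absolutelyContinuous _ _)
  rw [chartVolume, Measure.map_apply_of_aemeasurable hae hs,
    ← restrict_withDensity φ.open_target.measurableSet,
    Measure.restrict_apply' φ.open_target.measurableSet, inter_comm, withDensity_apply _ hm]

variable [IsManifold (𝓡 d) ∞ M]

/-- The volumes of two charts agree on the overlap of their domains. -/
lemma chartVolume_eq_chartVolume (hφ : φ ∈ atlas (EuclideanSpace ℝ (Fin d)) M)
    (hψ : ψ ∈ atlas (EuclideanSpace ℝ (Fin d)) M) {s : Set M} (hs : MeasurableSet s)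
    (hsφ : s ⊆ φ.source) (hsψ : s ⊆ ψ.source) : chartVolume ψ s = chartVolume φ s := by
  have hsrc : ∀ y ∈ ψ.target ∩ ψ.symm ⁻¹' s, y ∈ (ψ.symm.trans φ).source :=
    fun y hy ↦ ⟨hy.1, hsφ hy.2⟩
  have himg : (φ ∘ ψ.symm) '' (ψ.target ∩ ψ.symm ⁻¹' s) = φ.target ∩ φ.symm ⁻¹' s := by
    ext z
    constructor
    · rintro ⟨y, hy, rfl⟩
      refine ⟨φ.map_source (hsφ hy.2), ?_⟩
      simp only [mem_preimage, Function.comp_apply]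
      rw [φ.left_inv (hsφ hy.2)]
      exact hy.2
    · rintro ⟨hz, hzs⟩
      have hzs : φ.symm z ∈ s := hzs
      refine ⟨ψ (φ.symm z), ⟨ψ.map_source (hsψ hzs), ?_⟩, ?_⟩
      · simp only [mem_preimage]
        rwa [ψ.left_inv (hsψ hzs)]
      · simp only [Function.comp_apply]
        rw [ψ.left_inv (hsψ hzs), φ.right_inv hz]
  have hder : ∀ y ∈ ψ.target ∩ ψ.symm ⁻¹' s, HasFDerivWithinAt (φ ∘ ψ.symm)
      (fderiv ℝ (φ ∘ ψ.symm) y) (ψ.target ∩ ψ.symm ⁻¹' s) y := by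
    intro y hy
    have : MDifferentiableAt (𝓡 d) (𝓡 d) (φ ∘ ψ.symm) y :=
      ((chart_mdifferentiable hφ).mdifferentiableAt (hsφ hy.2)).comp y
        ((chart_mdifferentiable hψ).mdifferentiableAt_symm hy.1)
    exact this.differentiableAt.hasFDerivAt.hasFDerivWithinAt
  have hinj : InjOn (φ ∘ ψ.symm) (ψ.target ∩ ψ.symm ⁻¹' s) :=
    (ψ.symm.trans φ).injOn.mono hsrc
  have hm : MeasurableSet (ψ.target ∩ ψ.symm ⁻¹' s) :=
    ContinuousOn.measurableSet_inter_preimage ψ.continuousOn_symm ψ.open_target.measurableSet hs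
  rw [chartVolume_apply hs, chartVolume_apply hs, ← himg,
    lintegral_image_eq_lintegral_abs_det_fderiv_mul volume hm hder hinj]
  refine setLIntegral_congr_fun hm fun y hy ↦ ?_
  rw [volumeDensity_eq_abs_det_mul hφ hψ (hsrc y hy), ENNReal.ofReal_mul (abs_nonneg _)]
  rfl

/-- The Riemannian volume restricts to the chart volume on the domain of a chart. -/
lemma riemannianVolume_apply (hφ : φ ∈ atlas (EuclideanSpace ℝ (Fin d)) M) {s : Set M}
    (hs : MeasurableSet s) (hsφ : s ⊆ φ.source) :
    riemannianVolume d M s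
      = ∫⁻ y in φ.target ∩ φ.symm ⁻¹' s, ENNReal.ofReal (volumeDensity φ y) := by
  rw [← chartVolume_apply hs]
  have hm : MeasurableSet φ.source := φ.open_source.measurableSet
  refine le_antisymm ?_ (Measure.le_iff'.1 (le_iSup₂ (f := fun ψ _ ↦ chartVolume ψ) φ hφ) s)
  -- The right side dominates every chart volume: on `φ.source` by agreement on overlaps, off it
  -- trivially. It therefore dominates their supremum, and its second term vanishes on `s`.
  have hle : riemannianVolume d M
      ≤ chartVolume φ + (riemannianVolume d M).restrict φ.sourceᶜ := by
    refine iSup₂_le fun ψ hψ ↦ Measure.le_iff.2 fun t ht ↦ ?_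
    rw [Measure.add_apply, Measure.restrict_apply ht, ← measure_inter_add_sdiff t hm]
    refine add_le_add ?_ ?_
    · have hpart : chartVolume ψ (t ∩ φ.source) = chartVolume ψ (t ∩ φ.source ∩ ψ.source) := by
        rw [chartVolume_apply (ht.inter hm),
          chartVolume_apply ((ht.inter hm).inter ψ.open_source.measurableSet)]
        congr 2
        ext y
        simp only [mem_inter_iff, mem_preimage]
        exact ⟨fun h ↦ ⟨h.1, h.2, ψ.map_target h.1⟩, fun h ↦ ⟨h.1, h.2.1⟩⟩
      rw [hpart, chartVolume_eq_chartVolume hφ hψ ((ht.inter hm).inter ψ.open_source.measurableSet)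
        (inter_subset_left.trans inter_subset_right) inter_subset_right]
      exact measure_mono (inter_subset_left.trans inter_subset_left)
    · rw [sdiff_eq]
      exact Measure.le_iff'.1 (le_iSup₂ (f := fun ψ _ ↦ chartVolume ψ) ψ hψ) _
  refine (Measure.le_iff'.1 hle s).trans_eq ?_
  rw [Measure.add_apply, Measure.restrict_apply hs, ← sdiff_eq, sdiff_eq_empty.2 hsφ]
  simp

lemma isOpenPosMeasure_riemannianVolume
    [IsContMDiffRiemannianBundle (𝓡 d) ∞ (EuclideanSpace ℝ (Fin d))
      (fun x : M ↦ TangentSpace (𝓡 d) x)] : (riemannianVolume d M).IsOpenPosMeasure := by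
  refine ⟨fun U hU ⟨x, hx⟩ h0 ↦ ?_⟩
  set φ := chartAt (EuclideanSpace ℝ (Fin d)) x
  have hφ : φ ∈ atlas (EuclideanSpace ℝ (Fin d)) M := chart_mem_atlas _ x
  have hxφ : x ∈ φ.source := mem_chart_source _ x
  have h1 := measure_mono_null (inter_subset_left (t := φ.source)) h0
  rw [riemannianVolume_apply hφ (hU.measurableSet.inter φ.open_source.measurableSet)
    inter_subset_right] at h1
  set O := φ.target ∩ φ.symm ⁻¹' (U ∩ φ.source) with hO
  have hOo : IsOpen O := φ.symm.isOpen_inter_preimage (hU.inter φ.open_source)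
  have hxO : φ x ∈ O := by
    refine ⟨φ.map_source hxφ, ?_⟩
    simp only [mem_preimage]
    rw [φ.left_inv hxφ]
    exact ⟨hx, hxφ⟩
  have hae : AEMeasurable (fun y ↦ ENNReal.ofReal (volumeDensity φ y)) (volume.restrict O) :=
    (((contDiffOn_volumeDensity hφ).continuousOn.mono inter_subset_left).aemeasurable
      hOo.measurableSet).ennreal_ofReal
  rw [setLIntegral_eq_zero_iff' hOo.measurableSet hae] at h1
  refine (hOo.measure_pos volume ⟨_, hxO⟩).ne' (measure_mono_null (fun y hy ↦ ?_) h1)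
  simp only [mem_compl_iff, mem_ofPred_eq, Classical.not_imp]
  exact ⟨hy, by simpa using volumeDensity_pos hφ hy.1⟩

lemma isFiniteMeasure_riemannianVolume [CompactSpace M]
    [IsContMDiffRiemannianBundle (𝓡 d) ∞ (EuclideanSpace ℝ (Fin d))
      (fun x : M ↦ TangentSpace (𝓡 d) x)] : IsFiniteMeasure (riemannianVolume d M) := by
  refine ⟨isCompact_univ.measure_lt_top_of_nhdsWithin fun x _ ↦ ?_⟩
  rw [nhdsWithin_univ]
  set φ := chartAt (EuclideanSpace ℝ (Fin d)) x
  have hφ : φ ∈ atlas (EuclideanSpace ℝ (Fin d)) M := chart_mem_atlas _ x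
  have hxφ : x ∈ φ.source := mem_chart_source _ x
  have hc : ContinuousAt (volumeDensity φ) (φ x) :=
    (contDiffOn_volumeDensity hφ).continuousOn.continuousAt
      (φ.open_target.mem_nhds (φ.map_source hxφ))
  have hev := (hc.eventually (gt_mem_nhds (lt_add_one (volumeDensity φ (φ x))))).and
    (Metric.ball_mem_nhds (φ x) one_pos)
  obtain ⟨O, hO, hOo, hxO⟩ := eventually_nhds_iff.1 hev
  refine ⟨φ.source ∩ φ ⁻¹' O, (φ.isOpen_inter_preimage hOo).mem_nhds ⟨hxφ, hxO⟩, ?_⟩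
  rw [riemannianVolume_apply hφ (φ.isOpen_inter_preimage hOo).measurableSet inter_subset_left]
  have hsub : φ.target ∩ φ.symm ⁻¹' (φ.source ∩ φ ⁻¹' O) ⊆ O := by
    rintro y ⟨hy, hy1, hy2⟩
    simp only [mem_preimage] at hy2
    rwa [φ.right_inv hy] at hy2
  calc _ ≤ ∫⁻ y in O, ENNReal.ofReal (volumeDensity φ y) := lintegral_mono_set hsub
    _ ≤ ∫⁻ _ in O, ENNReal.ofReal (volumeDensity φ (φ x) + 1) :=
        setLIntegral_mono' hOo.measurableSet fun y hy ↦
          ENNReal.ofReal_le_ofReal (hO y hy).1.le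
    _ ≤ ENNReal.ofReal (volumeDensity φ (φ x) + 1) * volume (Metric.ball (φ x) 1) := by
        rw [setLIntegral_const]
        gcongr
        exact fun y hy ↦ (hO y hy).2
    _ < ⊤ := ENNReal.mul_lt_top ENNReal.ofReal_lt_top measure_ball_lt_top

end Volume

/-! ### The Jacobian of an inverse branch in charts. -/

section Jacobian

lemma contDiff_clm_det {d : ℕ} {n : WithTop ℕ∞} :
    ContDiff ℝ n fun A : EuclideanSpace ℝ (Fin d) →L[ℝ] EuclideanSpace ℝ (Fin d) ↦ A.det := by
  have h : ∀ A : EuclideanSpace ℝ (Fin d) →L[ℝ] EuclideanSpace ℝ (Fin d),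
      A.det = ∑ σ : Equiv.Perm (Fin d), Equiv.Perm.sign σ •
        ∏ i, (A (EuclideanSpace.single i (1 : ℝ))) (σ i) := fun A ↦ by
    rw [ContinuousLinearMap.det, ← LinearMap.det_toMatrix
      (EuclideanSpace.basisFun (Fin d) ℝ).toBasis, Matrix.det_apply]
    simp [LinearMap.toMatrix_apply]
  simp only [h]
  refine ContDiff.sum fun σ _ ↦ ContDiff.const_smul _ (contDiff_prod fun i _ ↦ ?_)
  exact (EuclideanSpace.proj (𝕜 := ℝ) (σ i) : EuclideanSpace ℝ (Fin d) →L[ℝ] ℝ).contDiff.comp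
    (ContinuousLinearMap.apply ℝ (EuclideanSpace ℝ (Fin d))
      (EuclideanSpace.single i (1 : ℝ))).contDiff

variable {d : ℕ} {M : Type*} [TopologicalSpace M]
    [ChartedSpace (EuclideanSpace ℝ (Fin d)) M]
    [RiemannianBundle (fun x : M ↦ TangentSpace (𝓡 d) x)]
    [IsManifold (𝓡 d) ∞ M]
    [IsContMDiffRiemannianBundle (𝓡 d) ∞ (EuclideanSpace ℝ (Fin d))
      (fun x : M ↦ TangentSpace (𝓡 d) x)]
    [MeasurableSpace M] [BorelSpace M]
    {φ ψ : OpenPartialHomeomorph M (EuclideanSpace ℝ (Fin d))}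

/-- The inverse of a local `C^2` diffeomorphism `Ψ` transforms the Riemannian volume by a Jacobian
whose logarithm is `C^1` in charts. -/
lemma exists_logJacobian (hφ : φ ∈ atlas (EuclideanSpace ℝ (Fin d)) M)
    (hψ : ψ ∈ atlas (EuclideanSpace ℝ (Fin d)) M) (Ψ : OpenPartialHomeomorph M M)
    (hΨ : ContMDiffOn (𝓡 d) (𝓡 d) 2 Ψ Ψ.source)
    (hΨ' : ContMDiffOn (𝓡 d) (𝓡 d) 2 Ψ.symm Ψ.target) {w₀ : M} (hw₀ : w₀ ∈ Ψ.target)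
    (hw₀ψ : w₀ ∈ ψ.source) (hw₀φ : Ψ.symm w₀ ∈ φ.source) :
    ∃ ℓ : EuclideanSpace ℝ (Fin d) → ℝ, ContDiffAt ℝ 1 ℓ (ψ w₀) ∧
      ∀ s : Set M, MeasurableSet s → s ⊆ Ψ.target → s ⊆ ψ.source → MapsTo Ψ.symm s φ.source →
        riemannianVolume d M (Ψ.source ∩ Ψ ⁻¹' s) = ∫⁻ y in ψ.target ∩ ψ.symm ⁻¹' s,
          ENNReal.ofReal (Real.exp (ℓ y)) * ENNReal.ofReal (volumeDensity ψ y) := by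
  have : IsManifold (𝓡 d) 2 M := IsManifold.of_le (n := ∞) ENat.LEInfty.out
  set χ := (ψ.symm.trans Ψ.symm).trans φ with hχ
  have hχsrc : ∀ y, y ∈ χ.source ↔ y ∈ ψ.target ∧ ψ.symm y ∈ Ψ.target ∧
      Ψ.symm (ψ.symm y) ∈ φ.source := fun y ↦ by
    simp [hχ, and_assoc]
  have hχapply : ∀ y, χ y = φ (Ψ.symm (ψ.symm y)) := fun y ↦ rfl
  have hΨm : Ψ.symm.MDifferentiable (𝓡 d) (𝓡 d) :=
    ⟨hΨ'.mdifferentiableOn (by norm_num), hΨ.mdifferentiableOn (by norm_num)⟩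
  have hχm : χ.MDifferentiable (𝓡 d) (𝓡 d) :=
    ((chart_mdifferentiable hψ).symm.trans hΨm).trans (chart_mdifferentiable hφ)
  have hχd : ∀ y ∈ χ.source, HasFDerivAt χ (fderiv ℝ χ y) y := fun y hy ↦
    (hχm.mdifferentiableAt hy).differentiableAt.hasFDerivAt
  have hdet : ∀ y ∈ χ.source, (fderiv ℝ χ y).det ≠ 0 := fun y hy ↦ by
    have h1 : Function.Injective (fderiv ℝ χ y) := by
      rw [← mfderiv_eq_fderiv]
      exact hχm.mfderiv_injective hy
    exact (LinearEquiv.isUnit_det'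
      (LinearEquiv.ofInjectiveEndo (fderiv ℝ χ y).toLinearMap h1)).ne_zero
  have hχ2 : ContDiffOn ℝ 2 χ χ.source := by
    have h1 : ContMDiffOn (𝓡 d) (𝓡 d) 2 φ φ.source :=
      contMDiffOn_of_mem_maximalAtlas (IsManifold.subset_maximalAtlas hφ)
    have h2 : ContMDiffOn (𝓡 d) (𝓡 d) 2 ψ.symm ψ.target :=
      contMDiffOn_symm_of_mem_maximalAtlas (IsManifold.subset_maximalAtlas hψ)
    refine ContMDiffOn.contDiffOn fun y hy ↦ ?_
    obtain ⟨hy1, hy2, hy3⟩ := (hχsrc y).1 hy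
    have k1 := (h1 _ hy3).contMDiffAt (φ.open_source.mem_nhds hy3)
    have k2 := (hΨ' _ hy2).contMDiffAt (Ψ.open_target.mem_nhds hy2)
    have k3 := (h2 _ hy1).contMDiffAt (ψ.open_target.mem_nhds hy1)
    exact (k1.comp y (k2.comp y k3)).contMDiffWithinAt
  have hpos : ∀ y ∈ χ.source, 0 < volumeDensity φ (χ y) := fun y hy ↦
    volumeDensity_pos hφ (φ.map_source ((hχsrc y).1 hy).2.2)
  have hposψ : ∀ y ∈ χ.source, 0 < volumeDensity ψ y := fun y hy ↦
    volumeDensity_pos hψ ((hχsrc y).1 hy).1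
  -- `Real.log` ignores signs, so no absolute value of the determinant is needed. One derivative of
  -- the `C^2` map `χ` is spent here, which leaves `C^1`.
  refine ⟨fun y ↦ Real.log (fderiv ℝ χ y).det + Real.log (volumeDensity φ (χ y))
    - Real.log (volumeDensity ψ y), ?_, fun s hs hsΨ hsψ hsφ ↦ ?_⟩
  · have hy : ψ w₀ ∈ χ.source := by
      rw [hχsrc, ψ.left_inv hw₀ψ]
      exact ⟨ψ.map_source hw₀ψ, hw₀, hw₀φ⟩
    have hχat : ContDiffAt ℝ 2 χ (ψ w₀) := hχ2.contDiffAt (χ.open_source.mem_nhds hy)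
    have h1 : ContDiffAt ℝ 1 (fun y ↦ (fderiv ℝ χ y).det) (ψ w₀) := by
      have h2 : ContDiffAt ℝ 1 (fderiv ℝ χ) (ψ w₀) := hχat.fderiv_right (by norm_num)
      exact contDiff_clm_det.contDiffAt.comp _ h2
    have h5 : ContDiffAt ℝ 1 (volumeDensity φ) (χ (ψ w₀)) :=
      (contDiffOn_volumeDensity hφ).contDiffAt (φ.open_target.mem_nhds
        (φ.map_source ((hχsrc _).1 hy).2.2))
    have h3 : ContDiffAt ℝ 1 (fun y ↦ volumeDensity φ (χ y)) (ψ w₀) :=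
      h5.comp _ (hχat.of_le (by norm_num))
    have h4 : ContDiffAt ℝ 1 (volumeDensity ψ) (ψ w₀) :=
      (contDiffOn_volumeDensity hψ).contDiffAt (ψ.open_target.mem_nhds ((hχsrc _).1 hy).1)
    exact ((h1.log (hdet _ hy)).add (h3.log (hpos _ hy).ne')).sub (h4.log (hposψ _ hy).ne')
  · set A := ψ.target ∩ ψ.symm ⁻¹' s with hA
    have hAm : MeasurableSet A :=
      ContinuousOn.measurableSet_inter_preimage ψ.continuousOn_symm ψ.open_target.measurableSet hs
    have hAχ : A ⊆ χ.source := fun y hy ↦ (hχsrc y).2 ⟨hy.1, hsΨ hy.2, hsφ hy.2⟩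
    have hpm : MeasurableSet (Ψ.source ∩ Ψ ⁻¹' s) :=
      ContinuousOn.measurableSet_inter_preimage Ψ.continuousOn Ψ.open_source.measurableSet hs
    have hpφ : Ψ.source ∩ Ψ ⁻¹' s ⊆ φ.source := by
      rintro u ⟨hu, hus⟩
      have := hsφ hus
      rwa [Ψ.left_inv hu] at this
    have himg : χ '' A = φ.target ∩ φ.symm ⁻¹' (Ψ.source ∩ Ψ ⁻¹' s) := by
      ext z
      constructor
      · rintro ⟨y, hy, rfl⟩
        have hy3 := ((hχsrc y).1 (hAχ hy)).2.2
        refine ⟨φ.map_source hy3, ?_⟩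
        rw [hχapply, mem_preimage, φ.left_inv hy3]
        refine ⟨Ψ.map_target (hsΨ hy.2), ?_⟩
        rw [mem_preimage, Ψ.right_inv (hsΨ hy.2)]
        exact hy.2
      · rintro ⟨hz, hz1, hz2⟩
        have hz2 : Ψ (φ.symm z) ∈ s := hz2
        refine ⟨ψ (Ψ (φ.symm z)), ⟨ψ.map_source (hsψ hz2), ?_⟩, ?_⟩
        · rwa [mem_preimage, ψ.left_inv (hsψ hz2)]
        · rw [hχapply, ψ.left_inv (hsψ hz2), Ψ.left_inv hz1, φ.right_inv hz]
    rw [riemannianVolume_apply hφ hpm hpφ, ← himg,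
      lintegral_image_eq_lintegral_abs_det_fderiv_mul volume hAm
        (fun y hy ↦ (hχd y (hAχ hy)).hasFDerivWithinAt) (χ.injOn.mono hAχ)]
    refine setLIntegral_congr_fun hAm fun y hy ↦ ?_
    have hy' := hAχ hy
    simp only
    rw [← ENNReal.ofReal_mul (abs_nonneg _), ← ENNReal.ofReal_mul (Real.exp_pos _).le,
      Real.exp_sub, Real.exp_add, Real.exp_log (hpos y hy'), Real.exp_log (hposψ y hy'),
      Real.exp_log_eq_abs (hdet y hy'), div_mul_cancel₀ _ (hposψ y hy').ne']

end Jacobian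

/-! ### The norm of the inverse derivative as a positive continuous function. -/

section InverseNorm

variable {d : ℕ} {M : Type*} [TopologicalSpace M]
    [ChartedSpace (EuclideanSpace ℝ (Fin d)) M]

lemma exists_openPartialHomeomorph_of_isLocalDiffeomorph {f : M → M}
    (hf : IsLocalDiffeomorph (𝓡 d) (𝓡 d) 2 f) (x : M) :
    ∃ Ψ : OpenPartialHomeomorph M M, x ∈ Ψ.source ∧ EqOn f Ψ Ψ.source ∧
      ContMDiffOn (𝓡 d) (𝓡 d) 2 Ψ Ψ.source ∧ ContMDiffOn (𝓡 d) (𝓡 d) 2 Ψ.symm Ψ.target ∧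
      Ψ.MDifferentiable (𝓡 d) (𝓡 d) := by
  obtain ⟨Φ, hx, heq⟩ := hf x
  exact ⟨Φ.toOpenPartialHomeomorph, hx, heq, Φ.contMDiffOn_toFun, Φ.contMDiffOn_invFun,
    Φ.contMDiffOn_toFun.mdifferentiableOn (by norm_num),
    Φ.contMDiffOn_invFun.mdifferentiableOn (by norm_num)⟩

variable [RiemannianBundle (fun x : M ↦ TangentSpace (𝓡 d) x)]

/-- The tangent spaces share one model space but carry norms that depend on the base point; this
transports an operator norm along an equality of points. -/
lemma opNorm_tangent_congr {w p q : M} (h : p = q)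
    (A : EuclideanSpace ℝ (Fin d) →L[ℝ] EuclideanSpace ℝ (Fin d)) :
    ‖(show TangentSpace (𝓡 d) w →L[ℝ] TangentSpace (𝓡 d) p from A)‖
      = ‖(show TangentSpace (𝓡 d) w →L[ℝ] TangentSpace (𝓡 d) q from A)‖ := by
  subst h; rfl

/-- The norm of the inverse derivative is the norm of the derivative of the inverse branch. -/
lemma invDerivNorm_eq {f : M → M} {Ψ : OpenPartialHomeomorph M M}
    (hΨ : Ψ.MDifferentiable (𝓡 d) (𝓡 d)) (hf : EqOn f Ψ Ψ.source) {x : M} (hx : x ∈ Ψ.source) :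
    invDerivNorm d f x = ‖mfderiv (𝓡 d) (𝓡 d) Ψ.symm (f x)‖ := by
  have hev : f =ᶠ[𝓝 x] Ψ := hf.eventuallyEq_of_mem (Ψ.open_source.mem_nhds hx)
  have hfx : f x = Ψ x := hf hx
  have hinv : Ψ.symm (f x) = x := by rw [hfx, Ψ.left_inv hx]
  set A : EuclideanSpace ℝ (Fin d) →L[ℝ] EuclideanSpace ℝ (Fin d) :=
    mfderiv (𝓡 d) (𝓡 d) f x with hA
  set G : EuclideanSpace ℝ (Fin d) →L[ℝ] EuclideanSpace ℝ (Fin d) :=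
    mfderiv (𝓡 d) (𝓡 d) Ψ.symm (f x) with hG
  have hA' : A = mfderiv (𝓡 d) (𝓡 d) Ψ x := hev.mfderiv_eq
  have hG' : G = mfderiv (𝓡 d) (𝓡 d) Ψ.symm (Ψ x) := by rw [hG, hfx]
  have h1 : G ∘L A = .id ℝ _ := by
    rw [hA', hG']
    exact hΨ.symm_comp_deriv hx
  have h2 : A ∘L G = .id ℝ _ := by
    have := hΨ.comp_symm_deriv (Ψ.map_source hx)
    rw [Ψ.left_inv hx] at this
    rw [hA', hG']
    exact this
  have h3 : A.inverse = G := ContinuousLinearMap.inverse_eq h2 h1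
  have h4 : invDerivNorm d f x
      = ‖(show TangentSpace (𝓡 d) (f x) →L[ℝ] TangentSpace (𝓡 d) x from A.inverse)‖ := rfl
  rw [h4, h3]
  exact (opNorm_tangent_congr hinv G).symm

lemma invDerivNorm_pos {f : M → M} (hf : IsLocalDiffeomorph (𝓡 d) (𝓡 d) 2 f) (hd : 0 < d)
    (x : M) :
    0 < invDerivNorm d f x := by
  obtain ⟨Ψ, hx, heq, -, h2, hm⟩ := exists_openPartialHomeomorph_of_isLocalDiffeomorph hf x
  have hfx : f x ∈ Ψ.target := by rw [heq hx]; exact Ψ.map_source hx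
  rw [invDerivNorm_eq hm heq hx]
  refine lt_of_le_of_ne (ContinuousLinearMap.opNorm_nonneg _) fun h0 ↦ ?_
  have hinj := hm.symm.mfderiv_injective hfx
  have : Nonempty (Fin d) := ⟨⟨0, hd⟩⟩
  obtain ⟨v, hv⟩ := exists_ne (0 : EuclideanSpace ℝ (Fin d))
  refine hv (hinj ?_)
  have hle := (mfderiv (𝓡 d) (𝓡 d) Ψ.symm (f x)).le_opNorm v
  rw [← h0, zero_mul] at hle
  have hz := norm_le_zero_iff.1 hle
  rw [hz]
  exact (map_zero (mfderiv (𝓡 d) (𝓡 d) Ψ.symm (f x))).symm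

variable [IsManifold (𝓡 d) ∞ M]
    [IsContMDiffRiemannianBundle (𝓡 d) ∞ (EuclideanSpace ℝ (Fin d))
      (fun x : M ↦ TangentSpace (𝓡 d) x)]

lemma continuous_invDerivNorm {f : M → M} (hf : IsLocalDiffeomorph (𝓡 d) (𝓡 d) 2 f) :
    Continuous (invDerivNorm d f) := by
  rw [continuous_iff_continuousAt]
  intro x
  obtain ⟨Ψ, hx, heq, -, h2, hm⟩ := exists_openPartialHomeomorph_of_isLocalDiffeomorph hf x
  have hfx : f x ∈ Ψ.target := by rw [heq hx]; exact Ψ.map_source hx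
  have h1 : ContMDiffAt (𝓡 d) (𝓡 d) 1 Ψ.symm (f x) :=
    ((h2 _ hfx).contMDiffAt (Ψ.open_target.mem_nhds hfx)).of_le one_le_two
  have h3 := continuousAt_opNorm_mfderiv h1
  refine (ContinuousAt.comp (f := f) h3 hf.contMDiff.continuous.continuousAt).congr ?_
  filter_upwards [Ψ.open_source.mem_nhds hx] with z hz
  exact (invDerivNorm_eq hm heq hz).symm

end InverseNorm

/-! ### Charts and inverse branches in the Riemannian distance. -/

section ChartNorm

variable {d : ℕ} {M : Type*} [TopologicalSpace M]
    [ChartedSpace (EuclideanSpace ℝ (Fin d)) M] [IsManifold (𝓡 d) 1 M]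
    [RiemannianBundle (fun x : M ↦ TangentSpace (𝓡 d) x)]
    [IsContinuousRiemannianBundle (EuclideanSpace ℝ (Fin d))
      (fun x : M ↦ TangentSpace (𝓡 d) x)] 

lemma exists_norm_mfderiv_chartAt_le (w₀ : M) : ∃ C : ℝ, 0 < C ∧ ∀ᶠ u in 𝓝 w₀,
    ∀ v : TangentSpace (𝓡 d) u,
      ‖(show EuclideanSpace ℝ (Fin d) from
        mfderiv (𝓡 d) (𝓡 d) (chartAt (EuclideanSpace ℝ (Fin d)) w₀) u v)‖ ≤ C * ‖v‖ := by
  obtain ⟨C, hC, hev⟩ := eventually_norm_mfderiv_extChartAt_lt (𝓡 d) w₀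
  refine ⟨C, hC, hev.mono fun u hu v ↦ ?_⟩
  let _ : NormedAddCommGroup (TangentSpace 𝓘(ℝ, EuclideanSpace ℝ (Fin d)) (extChartAt (𝓡 d) w₀ u)) :=
    normedAddCommGroupTangentSpaceVectorSpace _
  let _ : NormedSpace ℝ (TangentSpace 𝓘(ℝ, EuclideanSpace ℝ (Fin d)) (extChartAt (𝓡 d) w₀ u)) :=
    normedSpaceTangentSpaceVectorSpace _
  exact ContinuousLinearMap.le_of_opNorm_le _ hu.le v

end ChartNorm

section Branch

variable {d : ℕ} {M : Type*} [PseudoEMetricSpace M]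
    [ChartedSpace (EuclideanSpace ℝ (Fin d)) M] [IsManifold (𝓡 d) ∞ M]
    [RiemannianBundle (fun x : M ↦ TangentSpace (𝓡 d) x)]
    [IsContMDiffRiemannianBundle (𝓡 d) ∞ (EuclideanSpace ℝ (Fin d))
      (fun x : M ↦ TangentSpace (𝓡 d) x)] [IsRiemannianManifold (𝓡 d) M]

/-- Charts are locally Lipschitz for the Riemannian distance. -/
lemma exists_lipschitz_chartAt (w₀ : M) : ∃ C : NNReal, ∃ R : ℝ≥0∞, 0 < R ∧
    ∀ w, edist w w₀ < R → ∀ v, edist v w < R →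
      edist (chartAt (EuclideanSpace ℝ (Fin d)) w₀ v) (chartAt (EuclideanSpace ℝ (Fin d)) w₀ w)
        ≤ C * edist v w := by
  have : IsManifold (𝓡 d) 1 M := IsManifold.of_le (n := ∞) (by norm_num)
  obtain ⟨C, hC, hev⟩ := exists_norm_mfderiv_chartAt_le (d := d) w₀
  have hev2 := hev.and ((chartAt (EuclideanSpace ℝ (Fin d)) w₀).open_source.mem_nhds
    (mem_chart_source _ w₀))
  obtain ⟨R, hR, hball⟩ := Metric.nhds_basis_eball.eventually_iff.1 hev2
  refine ⟨C.toNNReal, R / 2, ENNReal.half_pos hR.ne', fun w hw v hv ↦ ?_⟩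
  have hsub : ∀ u ∈ Metric.eball w (R / 2), u ∈ Metric.eball w₀ R := fun u hu ↦ by
    rw [Metric.mem_eball] at *
    calc edist u w₀ ≤ edist u w + edist w w₀ := edist_triangle _ _ _
      _ < R / 2 + R / 2 := ENNReal.add_lt_add hu hw
      _ = R := ENNReal.add_halves R
  refine edist_image_le_of_enorm_mfderiv_le (I := 𝓡 d) (I' := 𝓡 d) (fun u hu ↦ ?_)
    (fun u hu ↦ ?_) (R := R / 2) hv
  · have hus := (hball (hsub u hu)).2
    exact contMDiffOn_chart.contMDiffAt ((chartAt _ w₀).open_source.mem_nhds hus)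
  · rw [enorm_le_coe, ← NNReal.coe_le_coe, Real.coe_toNNReal _ hC.le]
    refine ContinuousLinearMap.opNorm_le_bound _ hC.le fun v ↦ ?_
    have := (hball (hsub u hu)).1 v
    rw [norm_tangentSpace_vectorSpace]
    exact this

variable [MeasurableSpace M] [BorelSpace M]

/-- A local diffeomorphism has inverse branches with bounded distortion of the volume, that contract
almost as much as the inverse of the derivative. -/
lemma eventually_hasInverseBranch {f : M → M} (hf : IsLocalDiffeomorph (𝓡 d) (𝓡 d) 2 f)
    (hd : 0 < d) {κ : ℝ} (hκ : 1 < κ) (z₀ : M) : ∃ δ > 0, ∃ L, ∀ᶠ z in 𝓝 z₀,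
      HasInverseBranch f (invDerivNorm d f) (riemannianVolume d M) κ δ L z := by
  have hfc : Continuous f := hf.contMDiff.continuous
  obtain ⟨Ψ, hz₀, heq, hΨ, hΨ', hm⟩ := exists_openPartialHomeomorph_of_isLocalDiffeomorph hf z₀
  have hfz₀ : f z₀ ∈ Ψ.target := by rw [heq hz₀]; exact Ψ.map_source hz₀
  have hgf : ∀ z ∈ Ψ.source, Ψ.symm (f z) = z := fun z hz ↦ by rw [heq hz, Ψ.left_inv hz]
  have hfg : ∀ w ∈ Ψ.target, f (Ψ.symm w) = w := fun w hw ↦ by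
    rw [heq (Ψ.map_target hw), Ψ.right_inv hw]
  set φ := chartAt (EuclideanSpace ℝ (Fin d)) z₀
  set ψ := chartAt (EuclideanSpace ℝ (Fin d)) (f z₀)
  have hφ : φ ∈ atlas (EuclideanSpace ℝ (Fin d)) M := chart_mem_atlas _ _
  have hψ : ψ ∈ atlas (EuclideanSpace ℝ (Fin d)) M := chart_mem_atlas _ _
  have hz₀φ : z₀ ∈ φ.source := mem_chart_source _ _
  have hfz₀ψ : f z₀ ∈ ψ.source := mem_chart_source _ _
  obtain ⟨ℓ, hℓ, hvol⟩ := exists_logJacobian hφ hψ Ψ hΨ hΨ' hfz₀ hfz₀ψ (by rwa [hgf _ hz₀])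
  obtain ⟨K, t, ht, hKt⟩ := hℓ.exists_lipschitzOnWith
  obtain ⟨C, R, hR, hC⟩ := exists_lipschitz_chartAt (d := d) (f z₀)
  -- the norm of the derivative of the inverse branch
  set a₀ := invDerivNorm d f z₀
  have ha₀pos : 0 < a₀ := invDerivNorm_pos hf hd z₀
  -- One factor `√κ` pays for the variation of the inverse derivative near `f z₀`, the other for
  -- that of `invDerivNorm` near `z₀`.
  set κ₁ := √κ with hκ₁
  have hκ₁1 : 1 < κ₁ := by rw [hκ₁, Real.lt_sqrt zero_le_one]; simpa using hκ
  have hκ₁sq : κ₁ * κ₁ = κ := Real.mul_self_sqrt (by linarith)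
  have hg1 : ∀ w ∈ Ψ.target, ContMDiffAt (𝓡 d) (𝓡 d) 1 Ψ.symm w := fun w hw ↦
    ((hΨ' w hw).contMDiffAt (Ψ.open_target.mem_nhds hw)).of_le one_le_two
  have hnorm : ∀ᶠ w in 𝓝 (f z₀), ‖mfderiv (𝓡 d) (𝓡 d) Ψ.symm w‖ < κ₁ * a₀ := by
    refine (continuousAt_opNorm_mfderiv (hg1 _ hfz₀)).eventually (gt_mem_nhds ?_)
    change ‖mfderiv (𝓡 d) (𝓡 d) Ψ.symm (f z₀)‖ < κ₁ * a₀
    rw [← invDerivNorm_eq hm heq hz₀]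
    nlinarith
  have ha : ∀ᶠ z in 𝓝 z₀, a₀ / κ₁ < invDerivNorm d f z :=
    (continuous_invDerivNorm hf).continuousAt.eventually (lt_mem_nhds (div_lt_self ha₀pos hκ₁1))
  -- a good neighborhood of `f z₀`
  have hgood : ∀ᶠ w in 𝓝 (f z₀), w ∈ Ψ.target ∧ w ∈ ψ.source ∧ Ψ.symm w ∈ φ.source ∧ ψ w ∈ t ∧
      ‖mfderiv (𝓡 d) (𝓡 d) Ψ.symm w‖ < κ₁ * a₀ := by
    have hsymm : ∀ᶠ w in 𝓝 (f z₀), Ψ.symm w ∈ φ.source :=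
      (Ψ.symm.continuousAt hfz₀).eventually (φ.open_source.mem_nhds (by rwa [hgf _ hz₀]))
    filter_upwards [Ψ.open_target.mem_nhds hfz₀, ψ.open_source.mem_nhds hfz₀ψ, hsymm,
      (ψ.continuousAt hfz₀ψ).eventually ht, hnorm] with w h1 h2 h3 h4 h5
    exact ⟨h1, h2, h3, h4, h5⟩
  obtain ⟨R', hR', hball⟩ := Metric.nhds_basis_eball.eventually_iff.1 hgood
  -- The sum `δ + δ` keeps the whole ball of radius `δ` around `f z` in the good neighborhood
  -- whenever `f z` is within `δ` of `f z₀`.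
  obtain ⟨δ, hδ, hδR, hδR'⟩ : ∃ δ : ℝ, 0 < δ ∧ ENNReal.ofReal δ ≤ R ∧
      ENNReal.ofReal δ + ENNReal.ofReal δ ≤ R' := by
    obtain ⟨q, hq, hq'⟩ := ENNReal.lt_iff_exists_nnreal_btwn.1
      (lt_min hR (ENNReal.half_pos hR'.ne'))
    refine ⟨q, by simpa using hq, ?_, ?_⟩
    · rw [ENNReal.ofReal_coe_nnreal]
      exact hq'.le.trans (min_le_left _ _)
    · rw [ENNReal.ofReal_coe_nnreal, ← ENNReal.add_halves R']
      exact add_le_add (hq'.le.trans (min_le_right _ _)) (hq'.le.trans (min_le_right _ _))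
  -- `K` is a Lipschitz constant of the log Jacobian in the chart and `C` one of the chart, so the
  -- log Jacobian varies by at most `K * C * r` from the centre of a ball of radius `r`.
  refine ⟨δ, hδ, K * C, ?_⟩
  filter_upwards [ha, Ψ.open_source.mem_nhds hz₀, hfc.continuousAt.preimage_mem_nhds
    (Metric.eball_mem_nhds (f z₀) (ENNReal.ofReal_pos.2 hδ))] with z haz hz hfz
  have hfz : edist (f z) (f z₀) < ENNReal.ofReal δ := hfz
  have hsub : ∀ w ∈ Metric.eball (f z) (ENNReal.ofReal δ), w ∈ Metric.eball (f z₀) R' :=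
    fun w hw ↦ (edist_triangle _ (f z) _).trans_lt
      ((ENNReal.add_lt_add hw hfz).trans_le hδR')
  have hfzmem : f z ∈ Metric.eball (f z) (ENNReal.ofReal δ) :=
    Metric.mem_eball_self (ENNReal.ofReal_pos.2 hδ)
  refine ⟨Ψ.source ∩ f ⁻¹' Metric.eball (f z) (ENNReal.ofReal δ),
    Ψ.open_source.inter (Metric.isOpen_eball.preimage hfc), ⟨hz, hfzmem⟩, fun u hu ↦ hu.2,
    fun w hw ↦ ?_, fun u hu ↦ ?_, ENNReal.ofReal (Real.exp (ℓ (ψ (f z)))), fun r hr hrδ s hs hsm ↦ ?_⟩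
  · have hwT := (hball (hsub w hw)).1
    exact ⟨Ψ.symm w, ⟨Ψ.map_target hwT, by rwa [mem_preimage, hfg w hwT]⟩, hfg w hwT⟩
  · have := edist_image_le_of_enorm_mfderiv_le (I := 𝓡 d) (I' := 𝓡 d) (h := Ψ.symm) (x := f z)
      (R := ENNReal.ofReal δ) (K := (κ * invDerivNorm d f z).toNNReal)
      (fun w hw ↦ hg1 w (hball (hsub w hw)).1) (fun w hw ↦ ?_) hu.2
    · rw [hgf u hu.1, hgf z hz] at this
      exact this
    · have h1 := (hball (hsub w hw)).2.2.2.2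
      rw [enorm_le_coe, ← norm_toNNReal]
      refine Real.toNNReal_le_toNNReal (h1.le.trans ?_)
      rw [div_lt_iff₀ (by linarith)] at haz
      rw [← hκ₁sq]
      nlinarith
  · have hs' : s ⊆ Metric.eball (f z) (ENNReal.ofReal δ) :=
      hs.trans (Metric.eball_subset_eball (ENNReal.ofReal_le_ofReal hrδ))
    have hset : Ψ.source ∩ f ⁻¹' Metric.eball (f z) (ENNReal.ofReal δ) ∩ f ⁻¹' s
        = Ψ.source ∩ Ψ ⁻¹' s := by
      ext u
      simp only [mem_inter_iff, mem_preimage]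
      constructor
      · rintro ⟨⟨h1, -⟩, h2⟩
        exact ⟨h1, heq h1 ▸ h2⟩
      · rintro ⟨h1, h2⟩
        rw [← heq h1] at h2
        exact ⟨⟨h1, hs' h2⟩, h2⟩
    have hsψ : s ⊆ ψ.source := fun w hw ↦ (hball (hsub w (hs' hw))).2.1
    rw [hset, hvol s hsm (fun w hw ↦ (hball (hsub w (hs' hw))).1) hsψ
      (fun w hw ↦ (hball (hsub w (hs' hw))).2.2.1), riemannianVolume_apply hψ hsm hsψ]
    set A := ψ.target ∩ ψ.symm ⁻¹' s
    have hAm : MeasurableSet A :=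
      ContinuousOn.measurableSet_inter_preimage ψ.continuousOn_symm ψ.open_target.measurableSet hsm
    have hdist : ∀ y ∈ A, |ℓ y - ℓ (ψ (f z))| ≤ K * C * r := by
      rintro y ⟨hy, hys⟩
      have hys : ψ.symm y ∈ s := hys
      have h1 : edist (ψ (ψ.symm y)) (ψ (f z)) ≤ C * edist (ψ.symm y) (f z) :=
        hC _ (hfz.trans_le hδR) _ ((hs' hys).trans_le hδR)
      rw [ψ.right_inv hy] at h1
      have hyt : y ∈ t := by
        have := (hball (hsub _ (hs' hys))).2.2.2.1
        rwa [ψ.right_inv hy] at this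
      have h2 := hKt hyt (hball (hsub _ hfzmem)).2.2.2.1
      have h3 : edist (ψ.symm y) (f z) ≤ ENNReal.ofReal r := (hs hys).le
      have h4 : edist (ℓ y) (ℓ (ψ (f z))) ≤ ENNReal.ofReal (K * C * r) := by
        refine h2.trans ((mul_le_mul_right (h1.trans (mul_le_mul_right h3 _)) _).trans_eq ?_)
        rw [ENNReal.ofReal_mul (by positivity), ENNReal.ofReal_mul K.coe_nonneg,
          ENNReal.ofReal_coe_nnreal, ENNReal.ofReal_coe_nnreal, mul_assoc]
      rw [edist_dist, ENNReal.ofReal_le_ofReal_iff (by positivity), Real.dist_eq] at h4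
      exact h4
    rw [← lintegral_const_mul' _ _ ENNReal.ofReal_ne_top,
      ← lintegral_const_mul' _ _ ENNReal.ofReal_ne_top,
      ← lintegral_const_mul' _ _ ENNReal.ofReal_ne_top]
    constructor
    · refine setLIntegral_mono' hAm fun y hy ↦ ?_
      rw [← mul_assoc, ← ENNReal.ofReal_mul (p := Real.exp (K * C * r)) (Real.exp_pos _).le,
        ← Real.exp_add]
      gcongr
      have := (abs_le.1 (hdist y hy)).1
      linarith
    · refine setLIntegral_mono' hAm fun y hy ↦ ?_
      rw [← mul_assoc, ← ENNReal.ofReal_mul (p := Real.exp (K * C * r)) (Real.exp_pos _).le,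
        ← Real.exp_add]
      gcongr
      have := (abs_le.1 (hdist y hy)).2
      linarith

end Branch

/-! ### Uniform scales and nonsingularity on a compact space. -/

section Compact

variable {X : Type*} [PseudoEMetricSpace X] [CompactSpace X] {f : X → X}

/-- A locally injective map on a compact space is injective at a uniform scale. -/
lemma exists_injective_scale (h : ∀ x, ∃ U ∈ 𝓝 x, InjOn f U) :
    ∃ ε > 0, ∀ u v, edist u v < ENNReal.ofReal ε → f u = f v → u = v := by
  choose U hU hinj using h
  obtain ⟨ε, hε, hεU⟩ := lebesgue_number_lemma_of_emetric (c := fun x ↦ interior (U x))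
    isCompact_univ (fun _ ↦ isOpen_interior)
    fun x _ ↦ mem_iUnion.2 ⟨x, mem_interior_iff_mem_nhds.2 (hU x)⟩
  obtain ⟨q, hq, hqε⟩ := ENNReal.lt_iff_exists_nnreal_btwn.1 hε
  refine ⟨q, by simpa using hq, fun u v huv hfuv ↦ ?_⟩
  rw [ENNReal.ofReal_coe_nnreal] at huv
  obtain ⟨x, hx⟩ := hεU u trivial
  refine hinj x (interior_subset (hx (Metric.mem_eball_self hε)))
    (interior_subset (hx ?_)) hfuv
  rw [Metric.mem_eball, edist_comm]
  exact huv.trans hqε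

variable [MeasurableSpace X] [BorelSpace X] {μ : Measure X}

/-- Only the upper distortion bound is needed: on each branch domain a null set pulls back to a null
set, and finitely many domains cover the space. -/
lemma quasiMeasurePreserving_of_hasInverseBranch (hf : Continuous f) {a : X → ℝ} {κ δ L : ℝ}
    (hδ : 0 < δ) (hloc : ∀ z, HasInverseBranch f a μ κ δ L z) :
    Measure.QuasiMeasurePreserving f μ μ := by
  refine ⟨hf.measurable, Measure.AbsolutelyContinuous.mk fun s hs hμs ↦ ?_⟩
  rw [Measure.map_apply hf.measurable hs]
  choose U hUo hzU hmaps _ _ c hc using hloc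
  obtain ⟨t, ht⟩ := CompactSpace.elim_nhds_subcover U fun z ↦ (hUo z).mem_nhds (hzU z)
  have hcov : f ⁻¹' s ⊆ ⋃ z ∈ t, U z ∩ f ⁻¹' s := fun x hx ↦ by
    have hxt : x ∈ ⋃ z ∈ t, U z := by rw [ht]; trivial
    simp only [mem_iUnion] at hxt ⊢
    obtain ⟨z, hz, hxz⟩ := hxt
    exact ⟨z, hz, hxz, hx⟩
  refine measure_mono_null hcov ((measure_biUnion_null_iff t.countable_toSet).2 fun z _ ↦ ?_)
  have h := (hc z δ hδ.le le_rfl (s ∩ Metric.eball (f z) (ENNReal.ofReal δ)) inter_subset_right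
    (hs.inter Metric.isOpen_eball.measurableSet)).2
  rw [measure_mono_null inter_subset_left hμs, mul_zero, mul_zero] at h
  have hsub : U z ∩ f ⁻¹' s ⊆
      U z ∩ f ⁻¹' (s ∩ Metric.eball (f z) (ENNReal.ofReal δ)) :=
    fun x hx ↦ ⟨hx.1, hx.2, hmaps z hx.1⟩
  exact measure_mono_null hsub (nonpos_iff_eq_zero.1 h)

end Compact

/-! ### Application to the manifold in positive dimension. -/

section Finite

variable {d : ℕ} {M : Type*} [TopologicalSpace M] [CompactSpace M]
    [ChartedSpace (EuclideanSpace ℝ (Fin d)) M] [IsManifold (𝓡 d) ∞ M]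
    [RiemannianBundle (fun x : M ↦ TangentSpace (𝓡 d) x)]
    [IsContMDiffRiemannianBundle (𝓡 d) ∞ (EuclideanSpace ℝ (Fin d))
      (fun x : M ↦ TangentSpace (𝓡 d) x)]
    [MeasurableSpace M] [BorelSpace M]

lemma isFiniteMeasure_lebesgue [Nonempty M] : IsFiniteMeasure (lebesgue d M) := by
  have : IsFiniteMeasure (riemannianVolume d M) := isFiniteMeasure_riemannianVolume
  have : (riemannianVolume d M).IsOpenPosMeasure := isOpenPosMeasure_riemannianVolume
  refine ⟨?_⟩
  rw [lebesgue, Measure.smul_apply, smul_eq_mul, ENNReal.inv_mul_cancel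
    (isOpen_univ.measure_pos _ univ_nonempty).ne' (measure_ne_top _ _)]
  exact ENNReal.one_lt_top

end Finite

section Manifold

variable {d : ℕ} {M : Type*} [TopologicalSpace M] [T2Space M] [CompactSpace M]
    [ChartedSpace (EuclideanSpace ℝ (Fin d)) M] [IsManifold (𝓡 d) ∞ M]
    [RiemannianBundle (fun x : M ↦ TangentSpace (𝓡 d) x)]
    [IsContMDiffRiemannianBundle (𝓡 d) ∞ (EuclideanSpace ℝ (Fin d))
      (fun x : M ↦ TangentSpace (𝓡 d) x)]
    [MeasurableSpace M] [BorelSpace M]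

/-- A local diffeomorphism is nonsingular for the Riemannian volume, and its push-forwards at
hyperbolic times have bounded density. -/
lemma quasiMeasurePreserving_and_exists_domination {f : M → M}
    (hf : IsLocalDiffeomorph (𝓡 d) (𝓡 d) 2 f) (hd : 0 < d) {σ : ℝ} (hσ : σ ∈ Ioo (0 : ℝ) 1) :
    Measure.QuasiMeasurePreserving f (riemannianVolume d M) (riemannianVolume d M) ∧
    ∃ C : ℝ≥0∞, C ≠ ⊤ ∧ ∀ (n : ℕ) (s : Set M), MeasurableSet s →
      riemannianVolume d M ({x | IsHyperbolicTime d f σ n x} ∩ f^[n] ⁻¹' s)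
        ≤ C * riemannianVolume d M s := by
  have : IsManifold (𝓡 d) 1 M := IsManifold.of_le (n := ∞) (by norm_num)
  -- The distance of the Riemannian metric is introduced here, as an auxiliary structure for the
  -- preball argument.
  let _ : PseudoEMetricSpace M := .ofRiemannianMetric (𝓡 d) M
  have : IsRiemannianManifold (𝓡 d) M := inferInstance
  have : IsFiniteMeasure (riemannianVolume d M) := isFiniteMeasure_riemannianVolume
  have : (riemannianVolume d M).IsOpenPosMeasure := isOpenPosMeasure_riemannianVolume
  have hfc : Continuous f := hf.contMDiff.continuous
  have hsqrt : 0 < √σ := Real.sqrt_pos.2 hσ.1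
  have hsqrt1 : √σ < 1 := by rw [Real.sqrt_lt' one_pos]; simpa using hσ.2
  -- With `κ = (√σ)⁻¹`, each branch loses a factor `κ` and preballs still contract at the rate `κ *
  -- σ = √σ < 1`.
  have hκ : 1 < (√σ)⁻¹ := (one_lt_inv₀ hsqrt).2 hsqrt1
  have hκσ : (√σ)⁻¹ * σ < 1 := by
    nth_rewrite 2 [← Real.mul_self_sqrt hσ.1.le]
    rwa [inv_mul_cancel_left₀ hsqrt.ne']
  obtain ⟨ε, hε, hinj⟩ := exists_injective_scale (f := f) fun x ↦ by
    obtain ⟨Ψ, hx, heq, -⟩ := exists_openPartialHomeomorph_of_isLocalDiffeomorph hf x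
    exact ⟨Ψ.source, Ψ.open_source.mem_nhds hx, Ψ.injOn.congr heq.symm⟩
  obtain ⟨δ, hδ, hδε, L, hL, hloc⟩ := exists_uniform_inverseBranch hfc
    (eventually_hasInverseBranch hf hd hκ) (δ₀ := ε / 3) (by positivity)
  refine ⟨quasiMeasurePreserving_of_hasInverseBranch hfc hδ hloc, ?_⟩
  exact exists_domination_at_hyperbolicTime hfc (fun x ↦ (invDerivNorm_pos hf hd x).le)
    (by positivity) hσ.1 hκσ hδ hL hloc
    fun u v huv ↦ hinj u v (huv.trans_le (ENNReal.ofReal_le_ofReal (by linarith)))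

theorem exists_frequency_of_pos_dim [Nonempty M] {f : M → M}
    (hf : IsLocalDiffeomorph (𝓡 d) (𝓡 d) 2 f) (hd : 0 < d) {σ : ℝ} (hσ : σ ∈ Ioo (0 : ℝ) 1)
    (hex : ∀ᵐ x ∂(lebesgue d M), ∃ n : ℕ, IsHyperbolicTime d f σ n x)
    (hint : Integrable (fun x ↦ (firstHyperbolicTime d f σ x : ℝ)) (lebesgue d M)) :
    ∃ σ' ∈ Ioo (0 : ℝ) 1, ∃ θ : ℝ, 0 < θ ∧
      ∀ᵐ x ∂(lebesgue d M), θ ≤ hyperbolicFrequency d f σ' x := by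
  have := isFiniteMeasure_lebesgue (d := d) (M := M)
  obtain ⟨hqmp, C, hC, hdom⟩ := quasiMeasurePreserving_and_exists_domination hf hd hσ
  have hac := continuous_invDerivNorm hf
  obtain ⟨x₀, -, hx₀⟩ := isCompact_univ.exists_isMinOn univ_nonempty hac.continuousOn
  obtain ⟨x₁, -, hx₁⟩ := isCompact_univ.exists_isMaxOn univ_nonempty hac.continuousOn
  refine exists_frequency_of_domination (f := f) (a := invDerivNorm d f) (σ := σ)
    (hqmp.smul_measure _) hac.measurable (invDerivNorm_pos hf hd x₀)
    (fun x ↦ hx₀ (mem_univ x)) (fun x ↦ hx₁ (mem_univ x)) hσ hC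
    (fun n s hs ↦ ?_) hex hint
  rw [lebesgue, Measure.smul_apply, Measure.smul_apply, smul_eq_mul, smul_eq_mul, mul_left_comm]
  gcongr
  exact hdom n s hs

end Manifold

/-! ### Dimension zero, where the operator norm vanishes and logarithms are useless. -/

section DimensionZero

variable {M : Type*} [TopologicalSpace M] [ChartedSpace (EuclideanSpace ℝ (Fin 0)) M]
  [RiemannianBundle (fun x : M ↦ TangentSpace (𝓡 0) x)]

lemma invDerivNorm_dim_zero (f : M → M) (x : M) : invDerivNorm 0 f x = 0 := by
  have : Subsingleton (TangentSpace (𝓡 0) (f x)) :=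
    inferInstanceAs (Subsingleton (EuclideanSpace ℝ (Fin 0)))
  exact ContinuousLinearMap.opNorm_subsingleton _

lemma isHyperbolicTime_dim_zero (f : M → M) {σ : ℝ} (hσ : 0 ≤ σ) {n : ℕ} (hn : 1 ≤ n) (x : M) :
    IsHyperbolicTime 0 f σ n x := by
  refine ⟨hn, fun k hk hkn ↦ ?_⟩
  rw [Finset.prod_eq_zero (i := n - 1) (by simp; omega) (invDerivNorm_dim_zero f _)]
  positivity

/-- Every `n ≥ 1` is a hyperbolic time, so the count below `N` is `N - 1`, at least half of `N` once
`N ≥ 2`. -/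
lemma le_hyperbolicFrequency_dim_zero (f : M → M) {σ : ℝ} (hσ : 0 ≤ σ) (x : M) :
    1 / 2 ≤ hyperbolicFrequency 0 f σ x := by
  have hcard : ∀ N : ℕ, {n : ℕ | n < N ∧ IsHyperbolicTime 0 f σ n x}.ncard = N - 1 := fun N ↦ by
    have : {n : ℕ | n < N ∧ IsHyperbolicTime 0 f σ n x} = Finset.Ico 1 N := by
      ext n
      simp only [mem_ofPred_eq, Finset.coe_Ico, mem_Ico]
      exact ⟨fun h ↦ ⟨h.2.1, h.1⟩, fun h ↦ ⟨h.2, isHyperbolicTime_dim_zero f hσ h.1 x⟩⟩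
    rw [this, ncard_coe_finset, Nat.card_Ico]
  simp only [hyperbolicFrequency, hcard]
  refine le_liminf_of_le ?_ ?_
  · refine IsCoboundedUnder.of_frequently_le (a := 1) (Frequently.of_forall fun N ↦ ?_)
    exact div_le_one_of_le₀ (by exact_mod_cast Nat.sub_le N 1) (Nat.cast_nonneg N)
  · filter_upwards [eventually_ge_atTop 2] with N hN
    have hN' : (2 : ℝ) ≤ N := by exact_mod_cast hN
    rw [div_le_div_iff₀ two_pos (by linarith), Nat.cast_sub (by omega)]
    push_cast
    linarith

end DimensionZero

end HypTimes

/-! ### The main theorem, with the empty and zero-dimensional manifolds set apart. -/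

theorem mainTheorem3 {d : ℕ} {M : Type*}
    [TopologicalSpace M] [T2Space M] [CompactSpace M]
    [ChartedSpace (EuclideanSpace ℝ (Fin d)) M] [IsManifold (𝓡 d) ∞ M]
    [RiemannianBundle (fun x : M ↦ TangentSpace (𝓡 d) x)]
    [IsContMDiffRiemannianBundle (𝓡 d) ∞ (EuclideanSpace ℝ (Fin d))
      (fun x : M ↦ TangentSpace (𝓡 d) x)]
    [MeasurableSpace M] [BorelSpace M]
    (f : M → M) (hf : IsLocalDiffeomorph (𝓡 d) (𝓡 d) 2 f)
    (σ : ℝ) (hσ : σ ∈ Ioo (0 : ℝ) 1)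
    (hex : ∀ᵐ x ∂(HypTimes.lebesgue d M), ∃ n : ℕ, HypTimes.IsHyperbolicTime d f σ n x)
    (hint : Integrable (fun x ↦ (HypTimes.firstHyperbolicTime d f σ x : ℝ))
      (HypTimes.lebesgue d M)) :
    ∃ σ' ∈ Ioo (0 : ℝ) 1, ∃ θ : ℝ, 0 < θ ∧
      ∀ᵐ x ∂(HypTimes.lebesgue d M), θ ≤ HypTimes.hyperbolicFrequency d f σ' x := by
  rcases isEmpty_or_nonempty M with hM | hM
  · exact ⟨σ, hσ, 1, one_pos, Eventually.of_forall fun x ↦ hM.elim x⟩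
  rcases Nat.eq_zero_or_pos d with rfl | hd
  · exact ⟨σ, hσ, 1 / 2, by norm_num, Eventually.of_forall fun x ↦
      HypTimes.le_hyperbolicFrequency_dim_zero f hσ.1.le x⟩
  · exact HypTimes.exists_frequency_of_pos_dim hf hd hσ hex hint
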